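/- **Setting.** A *logic program* $P$ is a finite list of clauses $H \leftarrow B_1,\dots,B_n$ over terms built from variables, integers, the arithmetic operations $+,-,*$ and arbitrary functors. A body literal is a user-defined atom, a comparison $s\,\rho\,t$ with $\rho\in\{<,\le,\ge,>\}$, or $t\ \mathtt{is}\ e$. Comparisons and $\mathtt{is}$ evaluate ground integer expressions; they fail (have no resolvent) if an expression that has to be evaluated is not a ground integer expression. The *LD-tree* of a query $Q$ w.r.t. $P$ is the tree of all LD-derivations (SLD with leftmost selection, clause variants renamed apart from the current goal, most general unifiers) from $\leftarrow Q$. Fix a linear norm $\|f(t_1,\dots,t_n)\|=c+\sum a_i\|t_i\|$ with $c,a_i\in\mathbb N$ depending only on the functor. A *query pattern* $q$ is a predicate with a mode for each argument: $f$ (no assumption), $b$ (the symbolic norm of the argument contains no variable), $i$ (the argument is an integer or a ground integer expression). An atom *matches* $q$ if it has the same predicate and its arguments satisfy the modes. **The abstraction.** Given a set of argument positions treated as numerical and, for each predicate, a finite list of comparisons between its arguments, an atom is abstracted to its predicate, the exact modes of its arguments ($i$ recorded only at numerical positions, otherwise $b$), and, for each comparison, whether it holds (recorded as false when an argument attribute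 it mentions, a value or a norm, is undefined). Let $\sigma$ be a constraint solver that is sound over $\mathbb Z$: if it reports a finite system of integer polynomial comparisons as unsatisfiable, then the system has no integer solution. It need not be complete. All deductions below are made with $\sigma$ (a comparison is deduced if adding its negation is refuted). *Abstract answers* are the least set closed under the abstract immediate consequence operator: for each clause, all mode assignments to its variables and all choices of abstract answers for its body atoms that fit, all abstractions of the head are added that $\sigma$ does not refute. A *query-mapping pair* consists of a query (an abstract atom) and a mapping, given by a domain and a range (abstract atoms), directed arcs ("greater") and undirected edges ("equal") between nodes of the domain and the range; the arcs and edges compare norms of arguments of mode $b$ or $i$, or values of arguments of mode $i$. Pairs are generated from the abstractions of the queries matching $q$ and, repeatedly, from the ranges of generated pairs: for each clause $H\leftarrow B_1,\dots,B_n$ whose head has the predicate of the abstract query, each body atom $B_k$ and each description of the answers of $B_1,\dots,B_{k-1}$ by modes and abstract answers, the domain abstracts the instantiated head (at least as instantiated as the query, and agreeing with its comparisons), the range abstracts $B_k$, and the arcs and edges are those deduced. Two pairs are composed when the range of the first equals the query of the second. Pairs found inconsistent are dropped, and this is repeated until no new pair appears. A pair is *circular* if its query equals its range. Its *circular variant*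 adds circular edges joining corresponding range and domain nodes; a *forward positive cycle* is a closed walk in it through norm nodes that contains an arc and traverses circular edges only from range to domain. **Algorithm** $\mathsf{Analyse\_Termination}(P,q)$: 1. Structural analysis (TermiLog): with no numerical positions, compute the abstract answers (modes and order relations between the norms of arguments) and the query-mapping pairs. If the circular variant of every circular pair has a forward positive cycle, return YES. 2. If $P$ has no numerical loop, return NO. (A numerical loop: a strongly connected component of the predicate dependency graph that contains a cycle and has a clause whose body contains $\mathit{Var}\ \mathtt{is}\ \mathit{Exp}$, where $\mathit{Var}$ or a variable of $\mathit{Exp}$ is an argument of the head.) 3. Guess a set of numerical argument positions and keep those that are verified, i.e. that have mode $i$ in all abstract answers, or in all abstract queries that arise, in the abstraction without comparisons. 4. Compute the integer abstraction domain, given for each predicate by a finite list of comparisons between its numerical positions: either by collecting, from the recursive clauses among those of the numerical loops and of the predicates these depend on, the comparisons between variables and constants that restrict numerical head positions, or by any other technique, whose outcome may be an arbitrary such family of finite lists. 5. Compute abstract answers by modes and order relations between norms and, optionally, also by the comparisons of step 4 together with a further family of comparisons obtained in either way, where collecting now uses all clauses of $P$. 6. Compute the query-mapping pairs for the domain of step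 4, with the abstract answers of step 5. 7. For each circular pair: continue if its circular variant has a forward positive cycle. Otherwise guess an integer polynomial function $\varphi$ of the arguments; continue if $\varphi$ mentions only arguments that have mode $i$ in the query of the pair and $\sigma$ deduces, from the arcs, edges and constraints of domain and range, that $\varphi$ is non-negative on the domain and that its value decreases strictly from the domain to the range. Otherwise return NO. 8. Return YES. **Theorem.** Let $P$ be a logic program and $q$ a query pattern. For every linear norm, every sound solver $\sigma$ and every outcome of the guesses and choices in steps 3, 4, 5 and 7: - $\mathsf{Analyse\_Termination}(P,q)$ terminates, i.e. returns YES or NO after finitely many steps, where one step is one iteration of a fixpoint computation, the treatment of one pair, or the test for a numerical loop; - if $\mathsf{Analyse\_Termination}(P,q)$ returns YES, then for every query $Q$ matching $q$, the LD-tree of $Q$ w.r.t. $P$ is finite. -/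

import Mathlib

namespace LPTerm

/-! ### Logic programs with integer arithmetic -/

inductive ArithOp
  | add | sub | mul
  deriving DecidableEq

def ArithOp.eval : ArithOp → ℤ → ℤ → ℤ
  | .add, a, b => a + b
  | .sub, a, b => a - b
  | .mul, a, b => a * b

/-- Terms: variables, integers, arithmetic expressions, and compound terms `f(t₁,…,tₙ)`, where the
functor is identified by a name `f` and its arity `n` (constants have `n = 0`). -/
inductive Term
  | var (x : ℕ)
  | int (z : ℤ)
  | op (o : ArithOp) (s t : Term)
  | fn (f n : ℕ) (ts : Fin n → Term)

def Term.subst (θ : ℕ → Term) : Term → Term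
  | .var x => θ x
  | .int z => .int z
  | .op o s t => .op o (s.subst θ) (t.subst θ)
  | .fn f n ts => .fn f n fun i => (ts i).subst θ

def Term.vars : Term → List ℕ
  | .var x => [x]
  | .int _ => []
  | .op _ s t => s.vars ++ t.vars
  | .fn _ _ ts => (List.ofFn fun i => (ts i).vars).flatten

/-- The value of a ground integer expression; `none` for every other term. -/
def Term.value : Term → Option ℤ
  | .var _ => none
  | .int z => some z
  | .op o s t => s.value.bind fun a => t.value.map fun b => o.eval a b
  | .fn _ _ _ => none

inductive Rel
  | lt | le | ge | gt
  deriving DecidableEq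

def Rel.holds : Rel → ℤ → ℤ → Prop
  | .lt, a, b => a < b
  | .le, a, b => a ≤ b
  | .ge, a, b => a ≥ b
  | .gt, a, b => a > b

def Rel.neg : Rel → Rel
  | .lt => .ge
  | .le => .gt
  | .ge => .lt
  | .gt => .le

/-- A predicate is identified by its name and its arity. -/
abbrev Pred := ℕ × ℕ

structure Atom where
  name : ℕ
  args : List Term

def Atom.pred (a : Atom) : Pred := (a.name, a.args.length)

def Atom.subst (θ : ℕ → Term) (a : Atom) : Atom := ⟨a.name, a.args.map (Term.subst θ)⟩

def Atom.vars (a : Atom) : List ℕ := a.args.flatMap Term.vars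

/-- Body literals: user-defined atoms, comparisons `l ρ r`, and `t is e`. -/
inductive Literal
  | atom (a : Atom)
  | cmp (l : Term) (ρ : Rel) (r : Term)
  | assign (t e : Term)

def Literal.subst (θ : ℕ → Term) : Literal → Literal
  | .atom a => .atom (a.subst θ)
  | .cmp l ρ r => .cmp (l.subst θ) ρ (r.subst θ)
  | .assign t e => .assign (t.subst θ) (e.subst θ)

def Literal.vars : Literal → List ℕ
  | .atom a => a.vars
  | .cmp l _ r => l.vars ++ r.vars
  | .assign t e => t.vars ++ e.vars

def Literal.atom? : Literal → Option Atom
  | .atom a => some a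
  | _ => none

structure Clause where
  head : Atom
  body : List Literal

def Clause.subst (θ : ℕ → Term) (c : Clause) : Clause :=
  ⟨c.head.subst θ, c.body.map (Literal.subst θ)⟩

def Clause.vars (c : Clause) : List ℕ := (c.head.vars ++ c.body.flatMap Literal.vars).dedup

abbrev Program := List Clause
abbrev Goal := List Literal

/-! ### LD-resolution and LD-trees -/

/-- `θ` is a most general element of the set `U` of substitutions. -/
def IsMostGeneral (U : (ℕ → Term) → Prop) (θ : ℕ → Term) : Prop :=
  U θ ∧ ∀ η, U η → ∃ δ : ℕ → Term, ∀ x, η x = (θ x).subst δ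

/-- `Resolvent P b G G'`: the goal `G'` is obtained from `G` by one LD-resolution step, i.e. a step
on the leftmost literal.  The branch label `b` is `some i` when a variant, renamed apart, of the
`i`-th clause of `P` is used, and `none` when the leftmost literal is a built-in one.  A built-in
literal whose evaluation fails or raises an error has no resolvent. -/
inductive Resolvent (P : Program) : Option ℕ → Goal → Goal → Prop
  | clause (i : ℕ) (c : Clause) (A : Atom) (G : Goal) (ren : Equiv.Perm ℕ) (θ : ℕ → Term)
      (hc : P[i]? = some c)
      (hren : ∀ x ∈ c.vars, ren x ∉ (Literal.atom A :: G).flatMap Literal.vars)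
      (hθ : IsMostGeneral
        (fun η => A.subst η = ((c.subst fun x => .var (ren x)).head).subst η) θ) :
      Resolvent P (some i) (.atom A :: G)
        (((c.subst fun x => .var (ren x)).body ++ G).map (Literal.subst θ))
  | cmp (l r : Term) (ρ : Rel) (G : Goal) (a b : ℤ)
      (hl : l.value = some a) (hr : r.value = some b) (hρ : ρ.holds a b) :
      Resolvent P none (.cmp l ρ r :: G) G
  | assign (t e : Term) (G : Goal) (z : ℤ) (θ : ℕ → Term) (he : e.value = some z)
      (hθ : IsMostGeneral (fun η => t.subst η = .int z) θ) :
      Resolvent P none (.assign t e :: G) (G.map (Literal.subst θ))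

/-- An LD-tree for the goal `G₀` with respect to `P`.  A node is addressed by the list of branch
labels on the path from the root, the last one first; `label` gives the goal at each node, and
`none` at addresses that are not nodes.  A node has exactly one child for each branch label for
which a resolvent exists. -/
structure LDTree (P : Program) (G₀ : Goal) where
  label : List (Option ℕ) → Option Goal
  root : label [] = some G₀
  child : ∀ a b G G', label a = some G → label (b :: a) = some G' → Resolvent P b G G'
  complete : ∀ a b G, label a = some G → (∃ G', Resolvent P b G G') → (label (b :: a)).isSome
  closed : ∀ a b, label a = none → label (b :: a) = none

def LDTree.nodes {P : Program} {G₀ : Goal} (T : LDTree P G₀) : Set (List (Option ℕ)) :=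
  {a | (T.label a).isSome}

theorem LDTree.nonempty (P : Program) (G₀ : Goal) : Nonempty (LDTree P G₀) := by
  classical
  let f : List (Option ℕ) → Option Goal := fun a =>
    List.rec (motive := fun _ => Option Goal) (some G₀)
      (fun b _ ih => ih.bind fun G =>
        if h : ∃ G', Resolvent P b G G' then some h.choose else none) a
  have hf : ∀ b a, f (b :: a) = (f a).bind fun G =>
      if h : ∃ G', Resolvent P b G G' then some h.choose else none := fun _ _ => rfl
  refine ⟨⟨f, rfl, ?_, ?_, ?_⟩⟩
  · intro a b G G' h h'
    rw [hf, h] at h'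
    by_cases hx : ∃ G', Resolvent P b G G'
    · simp only [Option.bind_some, hx, dite_true, Option.some.injEq] at h'
      exact h' ▸ hx.choose_spec
    · simp [hx] at h'
  · intro a b G h hx
    simp [hf, h, hx]
  · intro a b h
    simp [hf, h]

/-! ### Linear norms, modes and query patterns -/

/-- An integer linear norm: `‖f(t₁,…,tₙ)‖ = c + ∑ aᵢ ‖tᵢ‖`, where the natural numbers `c`, `aᵢ`
depend only on the functor. -/
structure LinNorm where
  intConst : ℤ → ℕ
  opConst : ArithOp → ℕ
  opLeft : ArithOp → ℕ
  opRight : ArithOp → ℕ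
  fnConst : ℕ → ℕ → ℕ
  fnCoeff : (f n : ℕ) → Fin n → ℕ

/-- The norm of a term, in which variables count as `0`.  It is meaningful for the terms whose
symbolic norm contains no variable. -/
def Term.size (ν : LinNorm) : Term → ℕ
  | .var _ => 0
  | .int z => ν.intConst z
  | .op o s t => ν.opConst o + ν.opLeft o * s.size ν + ν.opRight o * t.size ν
  | .fn f n ts => ν.fnConst f n + ∑ i, ν.fnCoeff f n i * (ts i).size ν

/-- Every variable that occurs in the symbolic norm of the term satisfies `r`. -/
def Term.rigidIf (ν : LinNorm) (r : ℕ → Bool) : Term → Bool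
  | .var x => r x
  | .int _ => true
  | .op o s t => (ν.opLeft o == 0 || s.rigidIf ν r) && (ν.opRight o == 0 || t.rigidIf ν r)
  | .fn f n ts => (List.finRange n).all fun i => ν.fnCoeff f n i == 0 || (ts i).rigidIf ν r

/-- The term is instantiated enough with respect to the norm: its symbolic norm has no variable. -/
def Term.Rigid (ν : LinNorm) (t : Term) : Prop := t.rigidIf ν (fun _ => false) = true

/-- The term is an integer expression as soon as the variables satisfying `r` are. -/
def Term.intIf (r : ℕ → Bool) : Term → Bool
  | .var x => r x
  | .int _ => true
  | .op _ s t => s.intIf r && t.intIf r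
  | .fn _ _ _ => false

/-- Argument modes: free (no assumption), bound (instantiated enough), integer. -/
inductive Mode
  | f | b | i
  deriving DecidableEq

/-- The mode of a term that is determined by the modes of its variables. -/
def Term.mode (ν : LinNorm) (m : ℕ → Mode) (t : Term) : Mode :=
  if t.intIf (fun x => m x == .i) then .i
  else if t.rigidIf ν (fun x => m x != .f) then .b
  else .f

def Mode.le : Mode → Mode → Bool
  | .f, _ => true
  | .b, m => m != .f
  | .i, m => m == .i

structure Pattern where
  name : ℕ
  modes : List Mode

def Pattern.pred (q : Pattern) : Pred := (q.name, q.modes.length)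

def Term.Matches (ν : LinNorm) (t : Term) : Mode → Prop
  | .f => True
  | .b => t.Rigid ν
  | .i => ∃ z, t.value = some z

def Atom.Matches (ν : LinNorm) (Q : Atom) (q : Pattern) : Prop :=
  Q.name = q.name ∧ List.Forall₂ (Term.Matches ν) Q.args q.modes

/-! ### Integer constraints and constraint solvers -/

/-- Integer (polynomial) expressions over unknowns in `α`. -/
inductive AExp (α : Type)
  | const (z : ℤ)
  | unk (u : α)
  | add (s t : AExp α)
  | sub (s t : AExp α)
  | mul (s t : AExp α)
  deriving DecidableEq

def AExp.eval {α : Type} (v : α → ℤ) : AExp α → ℤ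
  | .const z => z
  | .unk u => v u
  | .add s t => s.eval v + t.eval v
  | .sub s t => s.eval v - t.eval v
  | .mul s t => s.eval v * t.eval v

def AExp.subst {α β : Type} (e : α → AExp β) : AExp α → AExp β
  | .const z => .const z
  | .unk u => e u
  | .add s t => .add (s.subst e) (t.subst e)
  | .sub s t => .sub (s.subst e) (t.subst e)
  | .mul s t => .mul (s.subst e) (t.subst e)

def AExp.unks {α : Type} : AExp α → List α
  | .const _ => []
  | .unk u => [u]
  | .add s t => s.unks ++ t.unks
  | .sub s t => s.unks ++ t.unks
  | .mul s t => s.unks ++ t.unks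

structure Constr (α : Type) where
  lhs : AExp α
  rel : Rel
  rhs : AExp α
  deriving DecidableEq

def Constr.holds {α : Type} (v : α → ℤ) (c : Constr α) : Prop :=
  c.rel.holds (c.lhs.eval v) (c.rhs.eval v)

def Constr.neg {α : Type} (c : Constr α) : Constr α := ⟨c.lhs, c.rel.neg, c.rhs⟩

def Constr.subst {α β : Type} (e : α → AExp β) (c : Constr α) : Constr β :=
  ⟨c.lhs.subst e, c.rel, c.rhs.subst e⟩

def Constr.unks {α : Type} (c : Constr α) : List α := c.lhs.unks ++ c.rhs.unks

/-- An argument has two numerical attributes: its norm and, for an integer expression, its value. -/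
inductive Kind
  | size | val
  deriving DecidableEq

/-- An attribute of the argument at a given position (counted from `0`). -/
abbrev Arg := ℕ × Kind

inductive Side
  | dom | mid | ran
  deriving DecidableEq

/-- Nodes of a mapping: attributes of the argument positions of its domain and range (and of the
middle atom, during composition). -/
abbrev Node := Side × Arg

/-- Unknowns of the constraint systems handed to the solver: attributes of clause variables, and
nodes of mappings. -/
inductive Unknown
  | var (x : ℕ) (k : Kind)
  | node (u : Node)
  deriving DecidableEq

/-- A constraint solver that is sound (not necessarily complete): whenever it reports that a finite
system of constraints is unsatisfiable, the system has no integer solution. -/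
structure Solver where
  refutes : List (Constr Unknown) → Bool
  sound : ∀ S, refutes S = true → ¬ ∃ v : Unknown → ℤ, ∀ c ∈ S, c.holds v

/-! ### The finite abstract domain -/

/-- For every predicate, a finite list of comparisons between its argument positions. -/
abbrev Family := Pred → List (Constr Arg)

/-- Parameters of an abstraction: the argument positions treated as numerical, and the comparisons
that classify calls and answers. -/
structure Config where
  num : Pred → ℕ → Bool
  call : Family
  ans : Family

/-- An abstract atom: a predicate, the modes of its arguments, and, for each comparison of the
family in use, whether it holds (`false` when it involves undefined attributes). -/
structure Cell where
  pred : Pred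
  modes : List Mode
  bits : List Bool
  deriving DecidableEq

/-- The norm is defined for arguments of mode `b` or `i`, the value for those of mode `i`. -/
def definedIn (modes : List Mode) (a : Arg) : Bool :=
  match modes[a.1]? with
  | some .i => true
  | some .b => a.2 == .size
  | _ => false

def Constr.definedIn (modes : List Mode) (c : Constr Arg) : Bool :=
  c.unks.all (LPTerm.definedIn modes)

def bitChoices (modes : List Mode) : List (Constr Arg) → List (List Bool)
  | [] => [[]]
  | c :: cs =>
    (if c.definedIn modes then [true, false] else [false]).flatMap fun b =>
      (bitChoices modes cs).map fun bs => b :: bs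

def cellsWith (C : Family) (p : Pred) (modes : List Mode) : List Cell :=
  (bitChoices modes (C p)).map fun bs => ⟨p, modes, bs⟩

/-- The constraints expressed by a cell: the comparisons that hold, and the negations of those that
do not, as far as their attributes are defined. -/
def Cell.constrs (C : Family) (e : Arg → AExp Unknown) (d : Cell) : List (Constr Unknown) :=
  ((C d.pred).zip d.bits).filterMap fun cb =>
    if cb.1.definedIn d.modes then some ((if cb.2 then cb.1 else cb.1.neg).subst e) else none

/-- The mode `i` is only recorded at numerical positions. -/
def Config.absMode (K : Config) (p : Pred) (j : ℕ) (md : Mode) : Mode :=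
  if md = .i ∧ K.num p j = false then .b else md

def Config.atomModes (K : Config) (ν : LinNorm) (m : ℕ → Mode) (a : Atom) : List Mode :=
  a.args.mapIdx fun j t => K.absMode a.pred j (t.mode ν m)

def Config.modesAt (K : Config) (p : Pred) (j : ℕ) : List Mode :=
  if K.num p j then [.f, .b, .i] else [.f, .b]

/-- All cells of a predicate. -/
def Config.allCells (K : Config) (C : Family) (p : Pred) : List Cell :=
  (((List.range p.2).map (K.modesAt p)).sections).flatMap (cellsWith C p)

/-- The cells of the queries that match a pattern. -/
def Config.initialCells (K : Config) (q : Pattern) : List Cell :=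
  (K.allCells K.call q.pred).filter fun d =>
    (q.modes.zipIdx.zip d.modes).all fun x => (K.absMode q.pred x.1.2 x.1.1).le x.2

/-- `d'` may describe an instance of an atom described by `d`: modes can only get more precise, and
comparisons whose attributes are already defined keep their truth value. -/
def Cell.extendsTo (C : Family) (d d' : Cell) : Bool :=
  d.pred == d'.pred &&
  (d.modes.length == d'.modes.length && (d.modes.zip d'.modes).all fun x => x.1.le x.2) &&
  ((C d.pred).zip (d.bits.zip d'.bits)).all fun x => !x.1.definedIn d.modes || x.2.1 == x.2.2

/-! ### Constraints read off a clause -/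

def Term.sizeExp (ν : LinNorm) : Term → AExp Unknown
  | .var x => .unk (.var x .size)
  | .int z => .const (ν.intConst z)
  | .op o s t => .add (.const (ν.opConst o))
      (.add (.mul (.const (ν.opLeft o)) (s.sizeExp ν)) (.mul (.const (ν.opRight o)) (t.sizeExp ν)))
  | .fn f n ts => .add (.const (ν.fnConst f n))
      ((List.ofFn fun i => AExp.mul (.const (ν.fnCoeff f n i)) ((ts i).sizeExp ν)).foldr
        .add (.const 0))

/-- The value of a term as an expression in the values of its variables; only used for terms that
denote integer expressions. -/
def Term.valExp : Term → AExp Unknown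
  | .var x => .unk (.var x .val)
  | .int z => .const z
  | .op .add s t => .add s.valExp t.valExp
  | .op .sub s t => .sub s.valExp t.valExp
  | .op .mul s t => .mul s.valExp t.valExp
  | .fn _ _ _ => .const 0

def Atom.argExp (ν : LinNorm) (a : Atom) (u : Arg) : AExp Unknown :=
  match a.args[u.1]?, u.2 with
  | some t, .size => t.sizeExp ν
  | some t, .val => t.valExp
  | none, _ => .const 0

/-- All assignments of modes to the listed variables (`f` elsewhere). -/
def modeAssignments : List ℕ → List (ℕ → Mode)
  | [] => [fun _ => .f]
  | x :: xs => (modeAssignments xs).flatMap fun m =>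
      [Mode.f, Mode.b, Mode.i].map fun md => Function.update m x md

/-- Assuming that the literals have succeeded and that `m` gives the modes of the variables, the
possible systems of constraints, one for each way of describing the answers of the user-defined
atoms by abstract answers from `A`. -/
def Config.bodySystems (K : Config) (ν : LinNorm) (A : List Cell) (m : ℕ → Mode) :
    List Literal → List (List (Constr Unknown))
  | [] => [[]]
  | .cmp l ρ r :: ls =>
    if l.intIf (fun x => m x == .i) && r.intIf (fun x => m x == .i) then
      (K.bodySystems ν A m ls).map fun S => ⟨l.valExp, ρ, r.valExp⟩ :: S
    else []
  | .assign t e :: ls =>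
    if t.intIf (fun x => m x == .i) && e.intIf (fun x => m x == .i) then
      (K.bodySystems ν A m ls).map fun S =>
        ⟨t.valExp, .le, e.valExp⟩ :: ⟨t.valExp, .ge, e.valExp⟩ :: S
    else []
  | .atom a :: ls =>
    (A.filter fun d => d.pred == a.pred && d.modes == K.atomModes ν m a).flatMap fun d =>
      (K.bodySystems ν A m ls).map fun S => d.constrs K.ans (a.argExp ν) ++ S

def Clause.nonneg (c : Clause) : List (Constr Unknown) :=
  c.vars.map fun x => ⟨.unk (.var x .size), .ge, .const 0⟩

/-! ### Abstract interpretation of answers -/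

/-- One application of the abstract immediate consequence operator to a set `A` of abstract
answers. -/
def Config.answerStep (K : Config) (σ : Solver) (ν : LinNorm) (P : Program) (A : List Cell) :
    List Cell :=
  P.flatMap fun c => (modeAssignments c.vars).flatMap fun m =>
    (K.bodySystems ν A m c.body).flatMap fun S =>
      (cellsWith K.ans c.head.pred (K.atomModes ν m c.head)).filter fun d =>
        !σ.refutes (S ++ c.nonneg ++ d.constrs K.ans (c.head.argExp ν))

/-! ### Query-mapping pairs -/

/-- A query-mapping pair: the query and the mapping, which consists of domain, range, (directed)
arcs and (undirected) edges.  An arc `(u, v)` says that `u` is greater than `v`, an edge that they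
are equal.  Arcs and edges join nodes of the same kind: norm arcs and edges, and numerical ones. -/
structure QMPair where
  query : Cell
  dom : Cell
  ran : Cell
  arcs : List (Node × Node)
  edges : List (Node × Node)
  deriving DecidableEq

def Cell.nodes (s : Side) (d : Cell) : List Node :=
  ((List.range d.modes.length).flatMap fun j => [(s, j, Kind.size), (s, j, Kind.val)]).filter
    fun u => definedIn d.modes u.2

/-- All pairs of nodes of the same kind of a mapping with domain `δ` and range `ρ`. -/
def nodePairs (δ ρ : Cell) : List (Node × Node) :=
  (List.product (δ.nodes .dom ++ ρ.nodes .ran) (δ.nodes .dom ++ ρ.nodes .ran)).filter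
    fun p => p.1.2.2 == p.2.2.2

/-- The query-mapping pair with all the arcs and edges that the solver can deduce from `S`, the
nodes being expressed by `e`; no pair if `S` is found to be inconsistent. -/
def mkPair (σ : Solver) (S : List (Constr Unknown)) (e : Node → AExp Unknown) (π δ ρ : Cell) :
    List QMPair :=
  if σ.refutes S then []
  else [⟨π, δ, ρ,
    (nodePairs δ ρ).filter fun p => σ.refutes (⟨e p.1, .le, e p.2⟩ :: S),
    (nodePairs δ ρ).filter fun p =>
      σ.refutes (⟨e p.1, .lt, e p.2⟩ :: S) && σ.refutes (⟨e p.1, .gt, e p.2⟩ :: S)⟩]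

/-- The user-defined atoms of a body, each with the literals that precede it. -/
def bodyCalls : List Literal → List (List Literal × Atom)
  | [] => []
  | l :: ls => (l.atom?.toList.map fun a => ([], a)) ++
      (bodyCalls ls).map fun pa => (l :: pa.1, pa.2)

/-- Nodes of a one-step mapping, expressed through the head and the body atom of the clause. -/
def stepExp (ν : LinNorm) (h a : Atom) : Node → AExp Unknown
  | (.dom, u) => h.argExp ν u
  | (_, u) => a.argExp ν u

/-- The query-mapping pairs for one rule application to the abstract query `π`: the clause head is
unified with the query, the literals before some body atom succeed, and this atom is reached. -/
def Config.stepPairs (K : Config) (σ : Solver) (ν : LinNorm) (P : Program) (A : List Cell)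
    (π : Cell) : List QMPair :=
  (P.filter fun c => c.head.pred == π.pred).flatMap fun c =>
    (modeAssignments c.vars).flatMap fun m =>
      (bodyCalls c.body).flatMap fun pa =>
        (K.bodySystems ν A m pa.1).flatMap fun S =>
          ((cellsWith K.call c.head.pred (K.atomModes ν m c.head)).filter fun δ =>
            π.extendsTo K.call δ).flatMap fun δ =>
            (cellsWith K.call pa.2.pred (K.atomModes ν m pa.2)).flatMap fun ρ =>
              mkPair σ (S ++ c.nonneg ++ δ.constrs K.call (c.head.argExp ν) ++
                ρ.constrs K.call (pa.2.argExp ν)) (stepExp ν c.head pa.2) π δ ρ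

def nodeExp (u : Node) : AExp Unknown := .unk (.node u)

/-- The constraints that a cell imposes on the nodes of one side. -/
def Cell.nodeConstrs (C : Family) (s : Side) (d : Cell) : List (Constr Unknown) :=
  d.constrs C (fun u => nodeExp (s, u)) ++
    ((d.nodes s).filter fun u => u.2.2 == .size).map fun u => ⟨nodeExp u, .ge, .const 0⟩

/-- The constraints expressed by arcs and edges, the domain being placed at side `s` and the range
at side `t`. -/
def QMPair.arcConstrs (μ : QMPair) (s t : Side) : List (Constr Unknown) :=
  let pl : Node → AExp Unknown := fun u => nodeExp (if u.1 = .dom then s else t, u.2)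
  (μ.arcs.map fun a => ⟨pl a.1, .gt, pl a.2⟩) ++
    μ.edges.flatMap fun a => [⟨pl a.1, .le, pl a.2⟩, ⟨pl a.1, .ge, pl a.2⟩]

/-- Composition of two pairs, defined when the range of the first is the query of the second.  The
domain of the composition may be further instantiated than the domain of the first pair. -/
def Config.compose (K : Config) (σ : Solver) (μ μ' : QMPair) : List QMPair :=
  if μ.ran = μ'.query then
    ((K.allCells K.call μ.dom.pred).filter fun δ => μ.dom.extendsTo K.call δ).flatMap fun δ =>
      mkPair σ (μ.arcConstrs .dom .mid ++ μ'.arcConstrs .mid .ran ++ δ.nodeConstrs K.call .dom ++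
        μ'.dom.nodeConstrs K.call .mid ++ μ'.ran.nodeConstrs K.call .ran) nodeExp
        μ.query δ μ'.ran
  else []

/-- One round of the generation of query-mapping pairs: rule applications to the initial queries
and to the ranges of the pairs found so far, and compositions of the pairs found so far. -/
def Config.pairStep (K : Config) (σ : Solver) (ν : LinNorm) (P : Program) (q : Pattern)
    (A : List Cell) (M : List QMPair) : List QMPair :=
  (K.initialCells q ++ M.map QMPair.ran).flatMap (K.stepPairs σ ν P A) ++
    M.flatMap fun μ => M.flatMap fun μ' => K.compose σ μ μ'

/-- A pair is circular if its query coincides with its range. -/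
def QMPair.circular (μ : QMPair) : Bool := μ.query == μ.ran

/-- Moves in the circular variant of a pair, restricted to norm nodes: along an arc, along an edge
in either direction, or along a circular edge from a range node to the corresponding domain node.
The flag records whether an arc has been traversed. -/
def QMPair.moves (μ : QMPair) (w : Node × Bool) : List (Node × Bool) :=
  if w.1.2.2 = .size then
    (μ.arcs.filterMap fun a => if a.1 = w.1 then some (a.2, true) else none) ++
    (μ.edges.filterMap fun a => if a.1 = w.1 then some (a.2, w.2) else none) ++
    (μ.edges.filterMap fun a => if a.2 = w.1 then some (a.1, w.2) else none) ++
    (if w.1.1 = .ran then [((.dom, w.1.2), w.2)] else [])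
  else []

/-- Everything that can be reached from `L` in at most `n` moves. -/
def reach {α : Type} [DecidableEq α] (next : α → List α) : ℕ → List α → List α
  | 0, L => L
  | n + 1, L => reach next n (L ++ L.flatMap next).dedup

/-- The circular variant has a forward positive cycle: a closed walk with at least one arc that
traverses circular edges only from the range to the domain. -/
def QMPair.forwardPositiveCycle (μ : QMPair) : Bool :=
  let V := μ.dom.nodes .dom ++ μ.ran.nodes .ran
  V.any fun u => decide ((u, true) ∈ reach μ.moves (2 * V.length) [(u, false)])

/-- The function `φ` of the numerical arguments is provably non-negative on the domain, and
provably decreases from the domain to the range. -/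
def Config.decreases (K : Config) (σ : Solver) (μ : QMPair) (φ : AExp Arg) : Bool :=
  let S := μ.arcConstrs .dom .ran ++ μ.dom.nodeConstrs K.call .dom ++
    μ.ran.nodeConstrs K.call .ran
  let φd := φ.subst fun u => nodeExp (.dom, u)
  let φr := φ.subst fun u => nodeExp (.ran, u)
  φ.unks.all (fun u => u.2 == .val && definedIn μ.query.modes u) &&
    σ.refutes (⟨φd, .lt, .const 0⟩ :: S) && σ.refutes (⟨φd, .le, φr⟩ :: S)

/-! ### Numerical loops and the collection of comparisons -/

def Program.preds (P : Program) : List Pred :=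
  (P.flatMap fun c => c.head.pred :: c.body.filterMap fun l => l.atom?.map Atom.pred).dedup

/-- Edges of the predicate dependency graph. -/
def Program.deps (P : Program) (p : Pred) : List Pred :=
  (P.filter fun c => c.head.pred == p).flatMap fun c =>
    c.body.filterMap fun l => l.atom?.map Atom.pred

/-- `q` can be reached from `p` along a nonempty path of the predicate dependency graph. -/
def Program.dependsOn (P : Program) (p q : Pred) : Bool :=
  decide (q ∈ reach P.deps P.preds.length (P.deps p))

/-- Position of the first head argument that is the variable `x` and satisfies `ok`. -/
def Clause.headPos (c : Clause) (ok : ℕ → Bool) (x : ℕ) : Option ℕ :=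
  (c.head.args.zipIdx.find? fun tj =>
    match tj.1 with
    | .var y => y == x && ok tj.2
    | _ => false).map Prod.snd

/-- The body contains `Var is Exp`, where `Var` or some variable of `Exp` is an argument of the
head. -/
def Clause.hasNumericStep (c : Clause) : Bool :=
  c.body.any fun l =>
    match l with
    | .assign (.var x) e => (x :: e.vars).any fun y => (c.headPos (fun _ => true) y).isSome
    | _ => false

/-- The clause belongs to a numerical loop: its predicate `p` lies on a cycle of the predicate
dependency graph, and some clause of a predicate in the strongly connected component of `p` has a
numeric step. -/
def Program.inNumericalLoop (P : Program) (p : Pred) : Bool :=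
  P.dependsOn p p && P.any fun c => c.hasNumericStep &&
    (c.head.pred == p || (P.dependsOn p c.head.pred && P.dependsOn c.head.pred p))

def Program.hasNumericalLoop (P : Program) : Bool := P.preds.any P.inNumericalLoop

/-- Clauses of the numerical loops and of the predicates on which these loops depend. -/
def Program.relevant (P : Program) : Program :=
  P.filter fun c => P.preds.any fun p =>
    P.inNumericalLoop p && (p == c.head.pred || P.dependsOn p c.head.pred)

def Program.isRecursive (P : Program) (c : Clause) : Bool :=
  c.body.any fun l => l.atom?.any fun a =>
    a.pred == c.head.pred || P.dependsOn a.pred c.head.pred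

def Clause.headExp (c : Clause) (ok : ℕ → Bool) : Term → Option (AExp Arg)
  | .var x => (c.headPos ok x).map fun j => .unk (j, .val)
  | .int z => some (.const z)
  | _ => none

/-- The comparisons between variables and constants in the body that restrict numerical argument
positions of the head. -/
def Clause.collect (num : Pred → ℕ → Bool) (c : Clause) : List (Constr Arg) :=
  c.body.filterMap fun l =>
    match l with
    | .cmp s ρ t => (c.headExp (num c.head.pred) s).bind fun s' =>
        (c.headExp (num c.head.pred) t).map fun t' => ⟨s', ρ, t'⟩
    | _ => none

/-- How the comparisons that generate an integer abstraction domain are obtained: by collecting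
those in the clauses, or by any other technique (inference by some engine, unfolding, propagation,
simplification), whose outcome is an arbitrary finite set of comparisons. -/
inductive DomainMethod
  | collecting
  | other (C : Family)

/-- The comparisons, between numerical argument positions, obtained from the clauses `S`. -/
def DomainMethod.comparisons (num : Pred → ℕ → Bool) (S : Program) : DomainMethod → Family
  | .collecting, p => (S.filter fun c => c.head.pred == p).flatMap (Clause.collect num)
  | .other C, p => (C p).filter fun c => c.unks.all fun u => u.2 == .val && num p u.1

/-! ### The algorithm -/

/-- What the algorithm leaves open: the constraint solver, the guess of numerical argument
positions, the technique for the integer abstraction domain, whether abstractions of answers are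
computed and with which refined domain, and the guesses of termination functions. -/
structure Choices where
  solver : Solver
  numGuess : Pred → ℕ → Bool
  domain : DomainMethod
  useAnswers : Bool
  ansDomain : DomainMethod
  termFun : QMPair → AExp Arg

/-- The order comparisons between the norms of the arguments. -/
def sizeOrder (p : Pred) : List (Constr Arg) :=
  ((List.product (List.range p.2) (List.range p.2)).filter fun jk => jk.1 != jk.2).map fun jk =>
    ⟨.unk (jk.1, .size), .gt, .unk (jk.2, .size)⟩

/-- Setting of the purely structural analysis: no numerical positions; answers are described by
instantiation and by order constraints between norms. -/
def termiLogConfig : Config := ⟨fun _ _ => false, fun _ => [], sizeOrder⟩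

/-- Setting for the discovery of numerical positions. -/
def numConfig (g : Choices) : Config := ⟨g.numGuess, fun _ => [], fun _ => []⟩

/-- A guessed position is verified if it is an integer in all abstract answers, or in all abstract
queries that arise. -/
def verified (g : Choices) (q : Pattern) (A : List Cell) (M : List QMPair) (p : Pred) (j : ℕ) :
    Bool :=
  let allInt : List Cell → Bool := fun L =>
    L.all fun d => d.pred != p || d.modes[j]? == some .i
  g.numGuess p j && (allInt A || allInt ((numConfig g).initialCells q ++ M.map QMPair.ran))

/-- Setting of the numerical analysis with numerical positions `num`. -/
def mainConfig (g : Choices) (P : Program) (num : Pred → ℕ → Bool) : Config where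
  num := num
  call := g.domain.comparisons num (P.relevant.filter P.isRecursive)
  ans := fun p => sizeOrder p ++
    (if g.useAnswers then
      g.domain.comparisons num (P.relevant.filter P.isRecursive) p ++
        g.ansDomain.comparisons num P p
    else [])

inductive Answer
  | yes | no
  deriving DecidableEq

/-- States of the algorithm. -/
inductive State
  | termiLogAnswers (A : List Cell)
  | termiLogPairs (A : List Cell) (M : List QMPair)
  | termiLogTest (todo : List QMPair)
  | loopTest
  | numAnswers (A : List Cell)
  | numPairs (A : List Cell) (M : List QMPair)
  | answers (K : Config) (A : List Cell)
  | pairs (K : Config) (A : List Cell) (M : List QMPair)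
  | test (K : Config) (todo : List QMPair)
  | halt (r : Answer)

/-- The elements of `T` that are not yet in `L`. -/
def newElems {α : Type} [DecidableEq α] (L T : List α) : List α :=
  (T.filter fun x => decide (x ∉ L)).dedup

/-- One step of the algorithm.  Each fixpoint is computed by iteration: a step adds the new
elements, and the next phase is entered when there are none. -/
def step (P : Program) (q : Pattern) (ν : LinNorm) (g : Choices) : State → State
  | .termiLogAnswers A =>
    match newElems A (termiLogConfig.answerStep g.solver ν P A) with
    | [] => .termiLogPairs A []
    | n :: ns => .termiLogAnswers (A ++ n :: ns)
  | .termiLogPairs A M =>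
    match newElems M (termiLogConfig.pairStep g.solver ν P q A M) with
    | [] => .termiLogTest M
    | n :: ns => .termiLogPairs A (M ++ n :: ns)
  | .termiLogTest [] => .halt .yes
  | .termiLogTest (μ :: todo) =>
    if !μ.circular || μ.forwardPositiveCycle then .termiLogTest todo else .loopTest
  | .loopTest => if P.hasNumericalLoop then .numAnswers [] else .halt .no
  | .numAnswers A =>
    match newElems A ((numConfig g).answerStep g.solver ν P A) with
    | [] => .numPairs A []
    | n :: ns => .numAnswers (A ++ n :: ns)
  | .numPairs A M =>
    match newElems M ((numConfig g).pairStep g.solver ν P q A M) with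
    | [] => .answers (mainConfig g P (verified g q A M)) []
    | n :: ns => .numPairs A (M ++ n :: ns)
  | .answers K A =>
    match newElems A (K.answerStep g.solver ν P A) with
    | [] => .pairs K A []
    | n :: ns => .answers K (A ++ n :: ns)
  | .pairs K A M =>
    match newElems M (K.pairStep g.solver ν P q A M) with
    | [] => .test K M
    | n :: ns => .pairs K A (M ++ n :: ns)
  | .test _ [] => .halt .yes
  | .test K (μ :: todo) =>
    if !μ.circular || μ.forwardPositiveCycle || K.decreases g.solver μ (g.termFun μ) then
      .test K todo
    else .halt .no
  | .halt r => .halt r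

/-- The state of `Analyse_Termination(P, q)` after `n` steps. -/
def analyse (P : Program) (q : Pattern) (ν : LinNorm) (g : Choices) (n : ℕ) : State :=
  (step P q ν g)^[n] (.termiLogAnswers [])

end LPTerm

/-!
The algorithm terminates because every fixpoint computation adds elements of a fixed finite list
(`Config.answerUniverse`, `Config.pairUniverse`), so that it ends with a closed list.  A positive
answer therefore comes with a configuration `K`, a list of abstract answers closed under the
abstract immediate consequence operator, and a list `M` of query-mapping pairs closed under the
generation of pairs, all of whose circular members pass one of the two tests (`Certified`).  This
alone implies termination, whatever the configuration: the guesses, and the verification of the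
numerical positions, only influence which certificate is found.

Suppose a query that matches the pattern has an infinite LD-derivation.  Then there is an infinite
chain of calls `Q₀, Q₁, …`: an instance `Dᵢ` of `Qᵢ` is an instance of a clause head, some literals
of the clause body succeed, and `Qᵢ₊₁` is the corresponding instance of the next body atom
(`terminates_of_calls`).  Neither renaming apart nor the generality of the unifiers matters
here, since success is described by logical consequence (`Provable`), which is stable under
instantiation.  Abstract answers describe all consequences (`Provable.described`): modes of
instances are determined by the modes of the terms put for the variables, the constraints read off
a clause are satisfied by the concrete norms and values, and a sound solver does not refute a
satisfied system.

For all `i < j` some pair in `M` has the abstractions of `Qᵢ`, `Dᵢ`, `Qⱼ` as query, domain and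
range, and its arcs and edges hold between the attributes of `Dᵢ` and `Qⱼ`
(`QMPair.Describes`).  This is proved by rule application (`Calls.exists_mem_stepPairs`) and
composition (`QMPair.Describes.exists_mem_compose`), using that defined attributes do not change
under instantiation.  As `M` is finite, an ultrafilter on the indices yields one pair `μ` that
describes successive segments of the chain for ever (`exists_recurrent`); it is circular.  Running
along a forward positive cycle, each circular edge being a passage to the next segment, one obtains
norms that decrease for ever; a function `φ` as in the second test decreases from each segment to
the next and stays non-negative.  Both are impossible
(`QMPair.Recurs.false_of_forwardPositiveCycle`, `QMPair.Recurs.false_of_decreases`).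
-/

namespace LPTerm

/-! ### Substitutions -/

theorem Term.subst_subst (θ δ : ℕ → Term) (t : Term) :
    (t.subst θ).subst δ = t.subst fun x => (θ x).subst δ := by
  induction t with
  | var x => rfl
  | int z => rfl
  | op o s t hs ht => simp only [Term.subst, hs, ht]
  | fn f n ts h => simp only [Term.subst, h]

theorem Term.subst_var (t : Term) : t.subst .var = t := by
  induction t with
  | var x => rfl
  | int z => rfl
  | op o s t hs ht => simp only [Term.subst, hs, ht]
  | fn f n ts h => simp only [Term.subst, h]

theorem Term.subst_congr {θ δ : ℕ → Term} {t : Term} (h : ∀ x ∈ t.vars, θ x = δ x) :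
    t.subst θ = t.subst δ := by
  induction t with
  | var x => exact h x (by simp [Term.vars])
  | int z => rfl
  | op o s t hs ht =>
    simp only [Term.vars, List.mem_append] at h
    simp only [Term.subst, hs fun x hx => h x (.inl hx), ht fun x hx => h x (.inr hx)]
  | fn f n ts ih =>
    have : ∀ i, (ts i).subst θ = (ts i).subst δ := fun i => ih i fun x hx => h x <| by
      simp only [Term.vars, List.mem_flatten, List.mem_ofFn]
      exact ⟨_, ⟨i, rfl⟩, hx⟩
    simp only [Term.subst, this]

theorem Atom.subst_subst (θ δ : ℕ → Term) (a : Atom) :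
    (a.subst θ).subst δ = a.subst fun x => (θ x).subst δ := by
  simp [Atom.subst, Term.subst_subst]

theorem Atom.subst_var (a : Atom) : a.subst .var = a := by
  have : Term.subst .var = id := funext Term.subst_var
  simp [Atom.subst, this]

theorem Atom.subst_congr {θ δ : ℕ → Term} {a : Atom} (h : ∀ x ∈ a.vars, θ x = δ x) :
    a.subst θ = a.subst δ := by
  simp only [Atom.subst, Atom.mk.injEq, true_and]
  exact List.map_congr_left fun t ht => Term.subst_congr fun x hx =>
    h x (List.mem_flatMap.2 ⟨t, ht, hx⟩)

@[simp] theorem Atom.pred_subst (θ : ℕ → Term) (a : Atom) : (a.subst θ).pred = a.pred := by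
  simp [Atom.pred, Atom.subst]

theorem Literal.subst_subst (θ δ : ℕ → Term) (l : Literal) :
    (l.subst θ).subst δ = l.subst fun x => (θ x).subst δ := by
  cases l <;> simp [Literal.subst, Term.subst_subst, Atom.subst_subst]

theorem Literal.subst_var (l : Literal) : l.subst .var = l := by
  cases l <;> simp [Literal.subst, Term.subst_var, Atom.subst_var]

theorem Literal.subst_congr {θ δ : ℕ → Term} {l : Literal} (h : ∀ x ∈ l.vars, θ x = δ x) :
    l.subst θ = l.subst δ := by
  cases l with
  | atom a => simp only [Literal.subst, Atom.subst_congr h]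
  | cmp l ρ r =>
    simp only [Literal.vars, List.mem_append] at h
    simp only [Literal.subst, Term.subst_congr fun x hx => h x (.inl hx),
      Term.subst_congr fun x hx => h x (.inr hx)]
  | assign t e =>
    simp only [Literal.vars, List.mem_append] at h
    simp only [Literal.subst, Term.subst_congr fun x hx => h x (.inl hx),
      Term.subst_congr fun x hx => h x (.inr hx)]

theorem map_subst_subst (θ δ : ℕ → Term) (G : Goal) :
    (G.map (Literal.subst θ)).map (Literal.subst δ) =
      G.map (Literal.subst fun x => (θ x).subst δ) := by
  simp [Literal.subst_subst]

/-- The substitution `η` restricted to the listed variables; all others are fixed, so that they have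
mode `f`, as in `modeAssignments`. -/
def restrictTo (xs : List ℕ) (η : ℕ → Term) (x : ℕ) : Term := if x ∈ xs then η x else .var x

theorem Clause.head_subst_restrictTo (c : Clause) (η : ℕ → Term) :
    c.head.subst (restrictTo c.vars η) = c.head.subst η :=
  Atom.subst_congr fun x hx => if_pos (by simp [Clause.vars, hx])

theorem Clause.literal_subst_restrictTo {c : Clause} {l : Literal} (hl : l ∈ c.body)
    (η : ℕ → Term) : l.subst (restrictTo c.vars η) = l.subst η :=
  Literal.subst_congr fun x hx => if_pos <| by
    simp only [Clause.vars, List.mem_dedup, List.mem_append, List.mem_flatMap]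
    exact .inr ⟨l, hl, hx⟩

/-! ### Values, modes and norms of instances -/

theorem Term.intIf_subst (η : ℕ → Term) (r : ℕ → Bool) (t : Term) :
    (t.subst η).intIf r = t.intIf fun x => (η x).intIf r := by
  induction t with
  | var x => rfl
  | int z => rfl
  | op o s t hs ht => simp only [Term.subst, Term.intIf, hs, ht]
  | fn f n ts h => rfl

theorem Term.intIf_mono {r r' : ℕ → Bool} (h : ∀ x, r x → r' x) {t : Term} :
    t.intIf r → t.intIf r' := by
  induction t with
  | var x => exact h x
  | int z => exact id
  | op o s t hs ht =>
    simp only [Term.intIf, Bool.and_eq_true]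
    exact And.imp hs ht
  | fn f n ts h => simp [Term.intIf]

theorem Term.rigidIf_subst (ν : LinNorm) (η : ℕ → Term) (r : ℕ → Bool) (t : Term) :
    (t.subst η).rigidIf ν r = t.rigidIf ν fun x => (η x).rigidIf ν r := by
  induction t with
  | var x => rfl
  | int z => rfl
  | op o s t hs ht => simp only [Term.subst, Term.rigidIf, hs, ht]
  | fn f n ts h => simp only [Term.subst, Term.rigidIf, h]

theorem Term.rigidIf_mono {ν : LinNorm} {r r' : ℕ → Bool} (h : ∀ x, r x → r' x) {t : Term} :
    t.rigidIf ν r → t.rigidIf ν r' := by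
  induction t with
  | var x => exact h x
  | int z => exact id
  | op o s t hs ht =>
    simp only [Term.rigidIf, Bool.and_eq_true, Bool.or_eq_true]
    exact And.imp (Or.imp id hs) (Or.imp id ht)
  | fn f n ts ih =>
    simp only [Term.rigidIf, List.all_eq_true, Bool.or_eq_true]
    exact fun H i hi => (H i hi).imp id (ih i)

theorem Term.rigidIf_of_intIf {ν : LinNorm} {r : ℕ → Bool} {t : Term} :
    t.intIf r → t.rigidIf ν r := by
  induction t with
  | var x => exact id
  | int z => exact id
  | op o s t hs ht =>
    simp only [Term.rigidIf, Term.intIf, Bool.and_eq_true, Bool.or_eq_true]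
    exact And.imp (fun h => .inr (hs h)) (fun h => .inr (ht h))
  | fn f n ts ih => simp [Term.intIf]

theorem Term.Rigid.subst {ν : LinNorm} {t : Term} (h : t.Rigid ν) (θ : ℕ → Term) :
    (t.subst θ).Rigid ν := by
  unfold Term.Rigid
  rw [Term.rigidIf_subst]
  exact Term.rigidIf_mono (by simp) h

/-- The norm of a term that is instantiated enough does not change under instantiation. -/
theorem Term.Rigid.size_subst {ν : LinNorm} {t : Term} (h : t.Rigid ν) (θ : ℕ → Term) :
    (t.subst θ).size ν = t.size ν := by
  induction t with
  | var x => simp [Term.Rigid, Term.rigidIf] at h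
  | int z => rfl
  | op o s t hs ht =>
    simp only [Term.Rigid, Term.rigidIf, Bool.and_eq_true, Bool.or_eq_true, beq_iff_eq] at h
    simp only [Term.subst, Term.size]
    have h1 : ν.opLeft o * (s.subst θ).size ν = ν.opLeft o * s.size ν := by
      rcases h.1 with h | h
      · simp [h]
      · rw [hs h]
    have h2 : ν.opRight o * (t.subst θ).size ν = ν.opRight o * t.size ν := by
      rcases h.2 with h | h
      · simp [h]
      · rw [ht h]
    rw [h1, h2]
  | fn f n ts ih =>
    simp only [Term.Rigid, Term.rigidIf, List.all_eq_true, Bool.or_eq_true, beq_iff_eq] at h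
    simp only [Term.subst, Term.size]
    congr 1
    refine Finset.sum_congr rfl fun i _ => ?_
    rcases h i (List.mem_finRange i) with h | h
    · simp [h]
    · rw [ih i h]

theorem Term.isSome_value (t : Term) : t.value.isSome = t.intIf fun _ => false := by
  induction t with
  | var x => rfl
  | int z => rfl
  | op o s t hs ht =>
    rw [Term.intIf, ← hs, ← ht, Term.value]
    cases s.value <;> cases t.value <;> rfl
  | fn f n ts ih => rfl

theorem Term.value_subst_of_eq_some {t : Term} {z : ℤ} (h : t.value = some z) (θ : ℕ → Term) :
    (t.subst θ).value = some z := by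
  induction t generalizing z with
  | var x => simp [Term.value] at h
  | int z => exact h
  | op o s t hs ht =>
    simp only [Term.value, Option.bind_eq_some_iff, Option.map_eq_some_iff] at h
    obtain ⟨a, ha, b, hb, rfl⟩ := h
    simp [Term.subst, Term.value, hs ha, ht hb]
  | fn f n ts ih => simp [Term.value] at h

/-- The mode of a term itself, its variables being free. -/
def Term.ownMode (ν : LinNorm) (t : Term) : Mode := t.mode ν fun _ => .f

theorem Term.ownMode_eq (ν : LinNorm) (t : Term) :
    t.ownMode ν =
      if t.value.isSome then .i else if t.rigidIf ν (fun _ => false) then .b else .f := by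
  rw [Term.isSome_value]
  rfl

theorem Term.ownMode_eq_i {ν : LinNorm} {t : Term} :
    t.ownMode ν = .i ↔ t.intIf (fun _ => false) = true := by
  rw [Term.ownMode_eq, Term.isSome_value]
  split_ifs <;> simp_all

theorem Term.ownMode_ne_f {ν : LinNorm} {t : Term} : t.ownMode ν ≠ .f ↔ t.Rigid ν := by
  rw [Term.ownMode_eq, Term.isSome_value, Term.Rigid]
  split_ifs with h1 h2
  · simp [Term.rigidIf_of_intIf h1]
  · simp [h2]
  · simp [h2]

/-- The mode of an instance is determined by the modes of the terms put for the variables. -/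
theorem Term.ownMode_subst (ν : LinNorm) (η : ℕ → Term) (t : Term) :
    (t.subst η).ownMode ν = t.mode ν fun x => (η x).ownMode ν := by
  have h1 : (fun x => ((η x).ownMode ν == Mode.i)) = fun x => (η x).intIf fun _ => false := by
    funext x
    rw [Bool.eq_iff_iff, beq_iff_eq, Term.ownMode_eq_i]
  have h2 : (fun x => ((η x).ownMode ν != Mode.f)) = fun x => (η x).rigidIf ν fun _ => false := by
    funext x
    rw [Bool.eq_iff_iff, bne_iff_ne, Term.ownMode_ne_f, Term.Rigid]
  rw [Term.ownMode_eq, Term.isSome_value, Term.mode, h1, h2, Term.intIf_subst, Term.rigidIf_subst]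

theorem Term.ownMode_subst_eq_i {ν : LinNorm} {t : Term} (h : t.ownMode ν = .i) (θ : ℕ → Term) :
    (t.subst θ).ownMode ν = .i := by
  rw [Term.ownMode_eq_i] at h ⊢
  rw [Term.intIf_subst]
  exact Term.intIf_mono (by simp) h

theorem Term.ownMode_subst_ne_f {ν : LinNorm} {t : Term} (h : t.ownMode ν ≠ .f) (θ : ℕ → Term) :
    (t.subst θ).ownMode ν ≠ .f := by
  rw [Term.ownMode_ne_f] at h ⊢
  exact h.subst θ

/-- The unknowns that stand for attributes of clause variables, evaluated at an instance. -/
def instVal (ν : LinNorm) (η : ℕ → Term) : Unknown → ℤ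
  | .var x .size => (η x).size ν
  | .var x .val => (η x).value.getD 0
  | .node _ => 0

theorem Term.eval_sizeExp (ν : LinNorm) (η : ℕ → Term) (t : Term) :
    (t.sizeExp ν).eval (instVal ν η) = (t.subst η).size ν := by
  induction t with
  | var x => rfl
  | int z => rfl
  | op o s t hs ht =>
    simp only [Term.sizeExp, AExp.eval, hs, ht, Term.subst, Term.size]
    push_cast
    ring
  | fn f n ts ih =>
    have key : ∀ l : List (AExp Unknown), (l.foldr AExp.add (.const 0)).eval (instVal ν η) =
        (l.map (AExp.eval (instVal ν η))).sum := by
      intro l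
      induction l with
      | nil => rfl
      | cons a l ih => simp [AExp.eval, ih]
    simp only [Term.sizeExp, AExp.eval, key, Term.subst, Term.size]
    push_cast
    simp only [List.map_ofFn, List.sum_ofFn, Function.comp_def, AExp.eval, ih]

theorem Term.value_subst {ν : LinNorm} {η : ℕ → Term} {t : Term}
    (h : t.intIf fun x => (η x).ownMode ν == .i) :
    (t.subst η).value = some (t.valExp.eval (instVal ν η)) := by
  induction t with
  | var x =>
    simp only [Term.intIf, beq_iff_eq, Term.ownMode_eq_i, ← Term.isSome_value] at h
    obtain ⟨z, hz⟩ := Option.isSome_iff_exists.1 h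
    simp [Term.subst, Term.valExp, AExp.eval, instVal, hz]
  | int z => rfl
  | op o s t hs ht =>
    simp only [Term.intIf, Bool.and_eq_true] at h
    rw [Term.subst, Term.value, hs h.1, ht h.2]
    cases o <;> rfl
  | fn f n ts ih => simp [Term.intIf] at h

theorem Term.intIf_of_value_subst {ν : LinNorm} {η : ℕ → Term} {t : Term} {z : ℤ}
    (h : (t.subst η).value = some z) : t.intIf fun x => (η x).ownMode ν == .i := by
  have h' : (t.subst η).intIf (fun _ => false) = true := by
    rw [← Term.isSome_value, h]
    rfl
  rw [Term.intIf_subst] at h'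
  refine Term.intIf_mono (fun x hx => ?_) h'
  rw [beq_iff_eq, Term.ownMode_eq_i]
  exact hx

/-- The numerical attributes of the arguments of an atom (`0` where the value is undefined). -/
def Atom.attr (ν : LinNorm) (a : Atom) (u : Arg) : ℤ :=
  match a.args[u.1]?, u.2 with
  | some t, .size => t.size ν
  | some t, .val => t.value.getD 0
  | none, _ => 0

theorem Atom.attr_size_nonneg (ν : LinNorm) (a : Atom) {u : Arg} (hu : u.2 = .size) :
    0 ≤ a.attr ν u := by
  obtain ⟨j, k⟩ := u
  obtain rfl : k = .size := hu
  unfold Atom.attr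
  cases a.args[j]? <;> simp

/-- The modes recorded for an atom, its variables being free. -/
def Config.ownModes (K : Config) (ν : LinNorm) (a : Atom) : List Mode :=
  K.atomModes ν (fun _ => .f) a

theorem Config.getElem?_atomModes (K : Config) (ν : LinNorm) (m : ℕ → Mode) (a : Atom) (j : ℕ) :
    (K.atomModes ν m a)[j]? = a.args[j]?.map fun t => K.absMode a.pred j (t.mode ν m) := by
  simp [Config.atomModes]

theorem Config.getElem?_ownModes (K : Config) (ν : LinNorm) (a : Atom) (j : ℕ) :
    (K.ownModes ν a)[j]? = a.args[j]?.map fun t => K.absMode a.pred j (t.ownMode ν) :=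
  K.getElem?_atomModes ν _ a j

theorem Config.ownModes_subst (K : Config) (ν : LinNorm) (η : ℕ → Term) (a : Atom) :
    K.ownModes ν (a.subst η) = K.atomModes ν (fun x => (η x).ownMode ν) a := by
  apply List.ext_getElem?
  intro j
  rw [Config.getElem?_ownModes, Config.getElem?_atomModes, Atom.pred_subst]
  simp [Atom.subst, Term.ownMode_subst, Function.comp_def]

theorem Config.absMode_eq_i {K : Config} {p : Pred} {j : ℕ} {md : Mode}
    (h : K.absMode p j md = .i) : md = .i := by
  unfold Config.absMode at h
  split_ifs at h
  exact h

theorem Config.absMode_eq_f {K : Config} {p : Pred} {j : ℕ} {md : Mode} :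
    K.absMode p j md = .f ↔ md = .f := by
  unfold Config.absMode
  split_ifs with h
  · simp [h.1]
  · rfl

theorem Config.absMode_le {K : Config} {p : Pred} {j : ℕ} {m m' : Mode} (h : m.le m') :
    (K.absMode p j m).le (K.absMode p j m') := by
  unfold Config.absMode
  cases K.num p j <;> cases m <;> cases m' <;> simp_all [Mode.le]

theorem Term.ownMode_le_subst (ν : LinNorm) (t : Term) (θ : ℕ → Term) :
    (t.ownMode ν).le ((t.subst θ).ownMode ν) := by
  cases h : t.ownMode ν with
  | f => rfl
  | b =>
    have := Term.ownMode_subst_ne_f (ν := ν) (t := t) (by simp [h]) θ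
    simpa [Mode.le] using this
  | i => simp [Mode.le, Term.ownMode_subst_eq_i h θ]

/-- A defined attribute belongs to an argument that is instantiated enough and, if it is a value, is
an integer expression. -/
theorem definedIn_atomModes {K : Config} {ν : LinNorm} {m : ℕ → Mode} {a : Atom} {u : Arg}
    (h : definedIn (K.atomModes ν m a) u = true) :
    ∃ t, a.args[u.1]? = some t ∧ t.mode ν m ≠ .f ∧ (u.2 = .val → t.mode ν m = .i) := by
  unfold definedIn at h
  rw [Config.getElem?_atomModes] at h
  cases ht : a.args[u.1]? with
  | none => simp [ht] at h
  | some t =>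
    refine ⟨t, rfl, ?_⟩
    rw [ht, Option.map_some] at h
    cases hm : K.absMode a.pred u.1 (t.mode ν m) with
    | f => simp [hm] at h
    | b =>
      rw [Ne, ← K.absMode_eq_f (p := a.pred) (j := u.1), hm]
      simp only [hm, beq_iff_eq] at h
      simp [h]
    | i => simp [K.absMode_eq_i hm]

/-- Attributes of an instance are given by the expressions read off the clause. -/
theorem Atom.eval_argExp {K : Config} {ν : LinNorm} {η : ℕ → Term} {a : Atom} {u : Arg}
    (h : definedIn (K.ownModes ν (a.subst η)) u = true) :
    (a.argExp ν u).eval (instVal ν η) = (a.subst η).attr ν u := by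
  rw [Config.ownModes_subst] at h
  obtain ⟨t, ht, -, hv⟩ := definedIn_atomModes h
  obtain ⟨j, k⟩ := u
  have ht' : (a.subst η).args[j]? = some (t.subst η) := by
    simp [Atom.subst, show a.args[j]? = _ from ht]
  simp only at ht
  cases k with
  | size => simp only [Atom.argExp, Atom.attr, ht, ht', Term.eval_sizeExp]
  | val =>
    have hi := hv rfl
    have : t.intIf fun x => (η x).ownMode ν == .i := by
      unfold Term.mode at hi
      split_ifs at hi with h1
      exact h1
    simp only [Atom.argExp, Atom.attr, ht, ht', Term.value_subst this, Option.getD_some]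

/-- Defined attributes do not change under instantiation. -/
theorem Atom.attr_subst {K : Config} {ν : LinNorm} {a : Atom} {u : Arg}
    (h : definedIn (K.ownModes ν a) u = true) (θ : ℕ → Term) :
    (a.subst θ).attr ν u = a.attr ν u := by
  obtain ⟨t, ht, hb, hv⟩ := definedIn_atomModes h
  obtain ⟨j, k⟩ := u
  have ht' : (a.subst θ).args[j]? = some (t.subst θ) := by
    simp [Atom.subst, show a.args[j]? = _ from ht]
  simp only at ht
  cases k with
  | size => simp only [Atom.attr, ht, ht', (Term.ownMode_ne_f.1 hb).size_subst θ]
  | val =>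
    have hi := Term.ownMode_eq_i.1 (hv rfl)
    rw [← Term.isSome_value] at hi
    obtain ⟨z, hz⟩ := Option.isSome_iff_exists.1 hi
    simp only [Atom.attr, ht, ht', hz, Term.value_subst_of_eq_some hz θ]

theorem definedIn_subst {K : Config} {ν : LinNorm} {a : Atom} {u : Arg}
    (h : definedIn (K.ownModes ν a) u = true) (θ : ℕ → Term) :
    definedIn (K.ownModes ν (a.subst θ)) u = true := by
  obtain ⟨t, ht, -, -⟩ := definedIn_atomModes h
  have ht' : (a.subst θ).args[u.1]? = some (t.subst θ) := by simp [Atom.subst, ht]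
  have hle := K.absMode_le (p := a.pred) (j := u.1) (t.ownMode_le_subst ν θ)
  unfold definedIn at h ⊢
  rw [Config.getElem?_ownModes, ht, Option.map_some] at h
  rw [Config.getElem?_ownModes, ht', Option.map_some, Atom.pred_subst]
  generalize K.absMode a.pred u.1 (t.ownMode ν) = m1 at *
  generalize K.absMode a.pred u.1 ((t.subst θ).ownMode ν) = m2 at *
  cases m1 <;> cases m2 <;> simp_all [Mode.le]

/-! ### Evaluating constraints -/

theorem Rel.holds_neg (ρ : Rel) (a b : ℤ) : ρ.neg.holds a b ↔ ¬ ρ.holds a b := by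
  cases ρ <;> simp [Rel.neg, Rel.holds]

theorem Constr.holds_neg {α : Type} (v : α → ℤ) (c : Constr α) : c.neg.holds v ↔ ¬ c.holds v :=
  Rel.holds_neg _ _ _

theorem AExp.eval_subst {α β : Type} (e : α → AExp β) (v : β → ℤ) (φ : AExp α) :
    (φ.subst e).eval v = φ.eval fun u => (e u).eval v := by
  induction φ with
  | const z => rfl
  | unk u => rfl
  | add s t hs ht => simp only [AExp.subst, AExp.eval, hs, ht]
  | sub s t hs ht => simp only [AExp.subst, AExp.eval, hs, ht]
  | mul s t hs ht => simp only [AExp.subst, AExp.eval, hs, ht]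

theorem AExp.eval_congr {α : Type} {v w : α → ℤ} {φ : AExp α} (h : ∀ u ∈ φ.unks, v u = w u) :
    φ.eval v = φ.eval w := by
  induction φ with
  | const z => rfl
  | unk u => exact h u (by simp [AExp.unks])
  | add s t hs ht | sub s t hs ht | mul s t hs ht =>
    simp only [AExp.unks, List.mem_append] at h
    simp only [AExp.eval, hs fun u hu => h u (.inl hu), ht fun u hu => h u (.inr hu)]

theorem Constr.holds_subst {α β : Type} (e : α → AExp β) (v : β → ℤ) (c : Constr α) :
    (c.subst e).holds v ↔ c.holds fun u => (e u).eval v := by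
  simp only [Constr.holds, Constr.subst, AExp.eval_subst]

theorem Constr.holds_congr {α : Type} {v w : α → ℤ} {c : Constr α}
    (h : ∀ u ∈ c.unks, v u = w u) : c.holds v ↔ c.holds w := by
  simp only [Constr.unks, List.mem_append] at h
  simp only [Constr.holds, AExp.eval_congr fun u hu => h u (.inl hu),
    AExp.eval_congr fun u hu => h u (.inr hu)]

theorem Solver.not_refutes (σ : Solver) {S : List (Constr Unknown)} {v : Unknown → ℤ}
    (hv : ∀ c ∈ S, c.holds v) : σ.refutes S = false :=
  Bool.eq_false_iff.2 fun h => σ.sound S h ⟨v, hv⟩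

theorem Solver.not_holds_of_refutes (σ : Solver) {S : List (Constr Unknown)} {v : Unknown → ℤ}
    (hv : ∀ c ∈ S, c.holds v) {c : Constr Unknown} (h : σ.refutes (c :: S) = true) :
    ¬ c.holds v := fun hc => σ.sound _ h ⟨v, List.forall_mem_cons.2 ⟨hc, hv⟩⟩

/-! ### The abstraction of an atom -/

open Classical in
/-- The abstraction of an atom: its predicate, the exact modes of its arguments, and the truth
values of the comparisons. -/
noncomputable def Config.cell (K : Config) (C : Family) (ν : LinNorm) (a : Atom) : Cell :=
  ⟨a.pred, K.ownModes ν a, (C a.pred).map fun c =>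
    decide (c.definedIn (K.ownModes ν a) = true ∧ c.holds (a.attr ν))⟩

theorem mem_bitChoices (modes : List Mode) (f : Constr Arg → Bool) (cs : List (Constr Arg))
    (hf : ∀ c ∈ cs, f c = true → c.definedIn modes = true) : cs.map f ∈ bitChoices modes cs := by
  induction cs with
  | nil => simp [bitChoices]
  | cons c cs ih =>
    have ih := ih fun c hc => hf c (List.mem_cons_of_mem _ hc)
    have hc := hf c List.mem_cons_self
    simp only [bitChoices, List.map_cons, List.mem_flatMap, List.mem_map]
    refine ⟨f c, ?_, cs.map f, ih, rfl⟩
    cases h : f c <;> simp_all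
    split_ifs <;> simp

theorem Config.cell_mem_cellsWith (K : Config) (C : Family) (ν : LinNorm) (a : Atom) :
    K.cell C ν a ∈ cellsWith C a.pred (K.ownModes ν a) := by
  refine List.mem_map.2 ⟨_, mem_bitChoices _ _ _ fun c _ hc => ?_, rfl⟩
  exact (by simpa using hc : _ ∧ c.holds (a.attr ν)).1

theorem Config.atomModes_mem_sections (K : Config) (ν : LinNorm) (m : ℕ → Mode) (a : Atom) :
    K.atomModes ν m a ∈ ((List.range a.pred.2).map (K.modesAt a.pred)).sections := by
  rw [List.mem_sections, List.forall₂_iff_get]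
  refine ⟨by simp [Config.atomModes, Atom.pred], fun j h1 h2 => ?_⟩
  simp only [Config.atomModes, List.get_eq_getElem, List.getElem_mapIdx, List.getElem_map,
    List.getElem_range]
  generalize (a.args[j]'_).mode ν m = md
  unfold Config.absMode Config.modesAt
  cases K.num a.pred j <;> cases md <;> simp

theorem Config.cellsWith_subset_allCells (K : Config) (C : Family) (ν : LinNorm) (m : ℕ → Mode)
    (a : Atom) : cellsWith C a.pred (K.atomModes ν m a) ⊆ K.allCells C a.pred := fun _ hd =>
  List.mem_flatMap.2 ⟨_, K.atomModes_mem_sections ν m a, hd⟩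

theorem Config.cell_mem_allCells (K : Config) (C : Family) (ν : LinNorm) (a : Atom) :
    K.cell C ν a ∈ K.allCells C a.pred :=
  K.cellsWith_subset_allCells C ν _ a (K.cell_mem_cellsWith C ν a)

/-- The abstraction of an atom only expresses constraints that hold for it. -/
theorem Config.holds_of_mem_constrs {K : Config} {C : Family} {ν : LinNorm} {a : Atom}
    {e : Arg → AExp Unknown} {v : Unknown → ℤ}
    (he : ∀ u, definedIn (K.ownModes ν a) u = true → (e u).eval v = a.attr ν u)
    {c : Constr Unknown} (hc : c ∈ (K.cell C ν a).constrs C e) : c.holds v := by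
  simp only [Cell.constrs, Config.cell, List.mem_filterMap, ← List.map_prod_left_eq_zip,
    List.mem_map] at hc
  obtain ⟨-, ⟨c₀, -, rfl⟩, hc⟩ := hc
  simp only at hc
  rw [ite_eq_iff] at hc
  obtain ⟨hd, hc⟩ | ⟨-, hc⟩ := hc
  swap
  · cases hc
  have hd' : ∀ u ∈ c₀.unks, definedIn (K.ownModes ν a) u = true := by
    simpa [Constr.definedIn] using hd
  have key : (c₀.holds fun u => (e u).eval v) ↔ c₀.holds (a.attr ν) :=
    Constr.holds_congr fun u hu => he u (hd' u hu)
  rw [Option.some.injEq] at hc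
  subst hc
  rw [Constr.holds_subst]
  split_ifs with hb
  · exact key.2 (by simpa [hd] using hb)
  · rw [Constr.holds_neg, key]
    intro h
    exact hb (by simpa [hd] using h)

theorem Config.cell_extendsTo (K : Config) (C : Family) (ν : LinNorm) (a : Atom)
    (θ : ℕ → Term) : (K.cell C ν a).extendsTo C (K.cell C ν (a.subst θ)) = true := by
  have hlen : (K.ownModes ν a).length = (K.ownModes ν (a.subst θ)).length := by
    simp [Config.ownModes, Config.atomModes, Atom.subst]
  simp only [Cell.extendsTo, Config.cell, Atom.pred_subst, beq_self_eq_true, Bool.true_and,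
    Bool.and_eq_true, hlen, List.all_eq_true]
  refine ⟨?_, ?_⟩
  · intro x hx
    obtain ⟨j, hj, rfl⟩ := List.getElem_of_mem hx
    have h1 : j < a.args.length := by
      have := hj
      simp [Config.ownModes, Config.atomModes] at this
      exact this.1
    simp only [List.getElem_zip, Config.ownModes, Config.atomModes, List.getElem_mapIdx,
      Atom.pred_subst]
    have : (a.subst θ).args[j]'(by simpa [Atom.subst] using h1) = (a.args[j]).subst θ := by
      simp [Atom.subst]
    rw [this]
    exact K.absMode_le (Term.ownMode_le_subst ν _ θ)
  · intro x hx
    rw [List.zip_map', ← List.map_prod_left_eq_zip] at hx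
    obtain ⟨c, -, rfl⟩ := List.mem_map.1 hx
    simp only [Bool.or_eq_true, Bool.not_eq_true', beq_iff_eq, decide_eq_decide]
    refine or_iff_not_imp_left.2 fun hd => ?_
    rw [Bool.not_eq_false] at hd
    have hd' : ∀ u ∈ c.unks, definedIn (K.ownModes ν a) u = true := by
      simpa [Constr.definedIn] using hd
    have hds : c.definedIn (K.ownModes ν (a.subst θ)) = true := by
      simpa [Constr.definedIn] using fun u₁ u₂ hu => definedIn_subst (hd' (u₁, u₂) hu) θ
    simp only [hd, hds, true_and]
    exact Constr.holds_congr fun u hu => (Atom.attr_subst (hd' u hu) θ).symm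

/-! ### Successful literals and calls -/

/-- The literals all of whose instances are logical consequences of the program, the built-in
literals having to evaluate successfully.  Instances of solved literals are provable, whatever the
later substitutions of a derivation do to them. -/
inductive Provable (P : Program) : Literal → Prop
  | atom (c : Clause) (hc : c ∈ P) (η : ℕ → Term) (h : ∀ l ∈ c.body, Provable P (l.subst η)) :
      Provable P (.atom (c.head.subst η))
  | cmp (l r : Term) (ρ : Rel) (a b : ℤ) (hl : l.value = some a) (hr : r.value = some b)
      (hρ : ρ.holds a b) : Provable P (.cmp l ρ r)
  | assign (e : Term) (z : ℤ) (he : e.value = some z) : Provable P (.assign (.int z) e)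

theorem Provable.subst {P : Program} {l : Literal} (h : Provable P l) (δ : ℕ → Term) :
    Provable P (l.subst δ) := by
  induction h with
  | atom c hc η h ih =>
    rw [Literal.subst, Atom.subst_subst]
    refine .atom c hc _ fun l hl => ?_
    rw [← Literal.subst_subst]
    exact ih l hl
  | cmp l r ρ a b hl hr hρ =>
    exact .cmp _ _ ρ a b (Term.value_subst_of_eq_some hl _) (Term.value_subst_of_eq_some hr _) hρ
  | assign e z he => exact .assign _ z (Term.value_subst_of_eq_some he _)

/-- The atom `B` is called by the atom `A`: an instance `A'` of `A` is an instance of a clause head,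
and `B` is the corresponding instance of a body atom of the clause, the preceding literals having
been solved.  In contrast to LD-resolution, no unifier has to be most general. -/
def Calls (P : Program) (A A' B : Atom) : Prop :=
  ∃ c ∈ P, ∃ η θ : ℕ → Term, A' = A.subst θ ∧ c.head.subst η = A' ∧
    ∃ pa ∈ bodyCalls c.body, (∀ l ∈ pa.1, Provable P (l.subst η)) ∧ B = pa.2.subst η

/-- All LD-derivations from the goal are finite. -/
def Terminates (P : Program) (G : Goal) : Prop :=
  Acc (fun G' G => ∃ b, Resolvent P b G G') G

theorem terminates_nil (P : Program) : Terminates P [] :=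
  Acc.intro _ fun _ ⟨_, h⟩ => by cases h

/-- A resolution step on `l :: (L ++ G)` restricts to a step on `l :: L`, and acts on `G` by a
substitution only.  If some instance of the new goal is solved, then so is the corresponding
instance of `l :: L`. -/
theorem Resolvent.exists_restrict {P : Program} {b : Option ℕ} {l : Literal} {L G G' : Goal}
    (h : Resolvent P b (l :: (L ++ G)) G') :
    ∃ (L' : Goal) (θ : ℕ → Term), Resolvent P b (l :: L) L' ∧
      G' = L' ++ G.map (Literal.subst θ) ∧
      ∀ δ : ℕ → Term, (∀ k ∈ L', Provable P (k.subst δ)) →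
        ∀ k ∈ l :: L, Provable P (k.subst fun x => (θ x).subst δ) := by
  generalize hM : l :: (L ++ G) = M at h
  cases h with
  | clause i c A M ren θ hc hren hθ =>
    obtain ⟨rfl, rfl⟩ := List.cons.inj hM
    refine ⟨((c.subst fun x => .var (ren x)).body ++ L).map (Literal.subst θ), θ,
      .clause i c A L ren θ hc (fun x hx hx' => hren x hx ?_) hθ, by simp, fun δ hδ k hk => ?_⟩
    · simp only [List.flatMap_cons, List.flatMap_append, List.mem_append] at hx' ⊢
      tauto
    · simp only [List.map_append, List.mem_append, Clause.subst, List.map_map] at hδ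
      rcases List.mem_cons.1 hk with rfl | hk
      · have hu : A.subst θ = (c.head.subst fun x => .var (ren x)).subst θ := hθ.1
        rw [← Literal.subst_subst, Literal.subst, hu, Literal.subst, Atom.subst_subst,
          Atom.subst_subst]
        refine .atom c (List.mem_of_getElem? hc) _ fun l hl => ?_
        have := hδ _ (.inl (List.mem_map.2 ⟨l, hl, rfl⟩))
        simpa only [Function.comp, Literal.subst_subst, Term.subst] using this
      · rw [← Literal.subst_subst]
        exact hδ _ (.inr (List.mem_map.2 ⟨k, hk, rfl⟩))
  | cmp l r ρ M a b hl hr hρ =>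
    obtain ⟨rfl, rfl⟩ := List.cons.inj hM
    refine ⟨L, .var, .cmp l r ρ L a b hl hr hρ, by simp [funext Literal.subst_var],
      fun δ hδ k hk => ?_⟩
    rcases List.mem_cons.1 hk with rfl | hk
    · exact .cmp _ _ ρ a b (Term.value_subst_of_eq_some hl _) (Term.value_subst_of_eq_some hr _) hρ
    · exact hδ k hk
  | assign t e M z θ he hθ =>
    obtain ⟨rfl, rfl⟩ := List.cons.inj hM
    refine ⟨L.map (Literal.subst θ), θ, .assign t e L z θ he hθ, by simp, fun δ hδ k hk => ?_⟩
    rcases List.mem_cons.1 hk with rfl | hk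
    · have hu : t.subst θ = .int z := hθ.1
      rw [Literal.subst, ← Term.subst_subst, hu]
      exact .assign _ z (Term.value_subst_of_eq_some he _)
    · rw [← Literal.subst_subst]
      exact hδ _ (List.mem_map.2 ⟨k, hk, rfl⟩)

/-- A goal can only fail to terminate in its first part, or in an instance of its second part for
which the first part is solved. -/
theorem Terminates.append {P : Program} {L : Goal} (hL : Terminates P L) (G : Goal)
    (hG : ∀ θ : ℕ → Term, (∀ l ∈ L, Provable P (l.subst θ)) →
      Terminates P (G.map (Literal.subst θ))) : Terminates P (L ++ G) := by
  induction hL generalizing G with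
  | intro L _ ih =>
    cases L with
    | nil => simpa [funext Literal.subst_var] using hG .var (by simp)
    | cons l L =>
      refine Acc.intro _ fun G' ⟨b, h⟩ => ?_
      obtain ⟨L', θ, hL', rfl, hp⟩ := h.exists_restrict
      refine ih L' ⟨b, hL'⟩ _ fun δ hδ => ?_
      rw [map_subst_subst]
      exact hG _ (hp δ hδ)

/-- An instance of a clause body terminates if all calls of body atoms, reached with the preceding
literals solved, terminate. -/
theorem terminates_of_calls_of_body {P : Program} (L : Goal) (η : ℕ → Term)
    (h : ∀ pa ∈ bodyCalls L, ∀ δ : ℕ → Term,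
      (∀ l ∈ pa.1, Provable P (l.subst fun x => (η x).subst δ)) →
      Terminates P [.atom (pa.2.subst fun x => (η x).subst δ)]) :
    Terminates P (L.map (Literal.subst η)) := by
  induction L generalizing η with
  | nil => exact terminates_nil P
  | cons l L ih =>
    rw [List.map_cons, ← List.singleton_append]
    refine Terminates.append ?_ _ fun θ hθ => ?_
    · cases l with
      | atom a =>
        have := h ([], a) (by simp [bodyCalls, Literal.atom?]) .var (by simp)
        rwa [← Atom.subst_subst, Atom.subst_var] at this
      | cmp l ρ r =>
        refine Acc.intro _ fun G' ⟨b, h⟩ => ?_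
        cases h
        exact terminates_nil P
      | assign t e =>
        refine Acc.intro _ fun G' ⟨b, h⟩ => ?_
        cases h
        exact terminates_nil P
    · rw [map_subst_subst]
      refine ih _ fun pa hpa δ hδ => ?_
      have := h (l :: pa.1, pa.2)
        (List.mem_append_right _ (List.mem_map.2 ⟨pa, hpa, rfl⟩)) (fun x => (θ x).subst δ)
      simp only [Term.subst_subst] at this hδ ⊢
      refine this (List.forall_mem_cons.2 ⟨?_, hδ⟩)
      have := (hθ _ (List.mem_singleton.2 rfl)).subst δ
      rwa [Literal.subst_subst, Literal.subst_subst] at this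

/-- If an atom has an infinite LD-derivation, then so has one of the atoms that it calls. -/
theorem terminates_of_calls {P : Program} {A : Atom}
    (h : ∀ A' B, Calls P A A' B → Terminates P [.atom B]) : Terminates P [.atom A] := by
  refine Acc.intro _ fun G' ⟨b, hr⟩ => ?_
  cases hr with
  | clause i c A G ren θ hc hren hθ =>
    have hu : A.subst θ = (c.head.subst fun x => .var (ren x)).subst θ := hθ.1
    simp only [List.append_nil, Clause.subst, map_subst_subst]
    refine terminates_of_calls_of_body _ _ fun pa hpa δ hδ => h (A.subst fun x => (θ x).subst δ) _
      ⟨c, List.mem_of_getElem? hc, _, _, rfl, ?_, pa, hpa, hδ, rfl⟩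
    rw [← Atom.subst_subst θ, hu, Atom.subst_subst, Atom.subst_subst]
    rfl

/-- An LD-tree is finitely branching, so it is finite if it has no infinite branch. -/
theorem LDTree.finite_nodes {P : Program} {G₀ : Goal} (T : LDTree P G₀) (h : Terminates P G₀) :
    T.nodes.Finite := by
  have none_above : ∀ a, T.label a = none → ∀ l : List (Option ℕ), T.label (l ++ a) = none := by
    intro a ha l
    induction l with
    | nil => exact ha
    | cons b l ih => exact T.closed _ b ih
  have key : ∀ G, Terminates P G → ∀ a, T.label a = some G →
      {l : List (Option ℕ) | (T.label (l ++ a)).isSome}.Finite := by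
    intro G hG
    induction hG with
    | intro G _ ih =>
      intro a ha
      let labels : Set (Option ℕ) := insert none (some '' Set.Iio P.length)
      have hlabels : labels.Finite := ((Set.finite_Iio _).image _).insert _
      refine ((hlabels.biUnion (t := fun b => (· ++ [b]) ''
        {l : List (Option ℕ) | (T.label (l ++ b :: a)).isSome}) fun b _ =>
          Set.Finite.image _ ?_).insert []).subset fun l hl => ?_
      · cases hb : T.label (b :: a) with
        | none => simp [none_above _ hb]
        | some G' => exact ih G' ⟨b, T.child a b G G' ha hb⟩ _ hb
      · rcases List.eq_nil_or_concat l with rfl | ⟨l, b, rfl⟩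
        · exact .inl rfl
        · rw [List.concat_eq_append] at hl ⊢
          simp only [Set.mem_ofPred_eq, List.append_assoc, List.singleton_append] at hl
          refine .inr (Set.mem_biUnion (x := b) ?_ ⟨l, hl, rfl⟩)
          cases hb : T.label (b :: a) with
          | none => simp [none_above _ hb] at hl
          | some G' =>
            cases T.child a b G G' ha hb with
            | clause i c A G ren θ hc =>
              exact .inr ⟨i, (List.getElem?_eq_some_iff.1 hc).1, rfl⟩
            | cmp => exact .inl rfl
            | assign => exact .inl rfl
  simpa [LDTree.nodes] using key G₀ h [] T.root

/-! ### Abstract answers -/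

/-- What the abstract answers `A` have to say about a literal that has succeeded. -/
def LitDescribed (K : Config) (ν : LinNorm) (A : List Cell) : Literal → Prop
  | .atom a => K.cell K.ans ν a ∈ A
  | .cmp l ρ r => ∃ a b, l.value = some a ∧ r.value = some b ∧ ρ.holds a b
  | .assign t e => ∃ z, t = .int z ∧ e.value = some z

/-- The modes of the terms put for the variables. -/
def instModes (ν : LinNorm) (η : ℕ → Term) (x : ℕ) : Mode := (η x).ownMode ν

theorem instModes_mem_modeAssignments (ν : LinNorm) (η : ℕ → Term) (xs : List ℕ) :
    instModes ν (restrictTo xs η) ∈ modeAssignments xs := by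
  induction xs with
  | nil => exact List.mem_singleton.2 rfl
  | cons x xs ih =>
    refine List.mem_flatMap.2 ⟨_, ih, List.mem_map.2 ⟨(η x).ownMode ν, ?_, ?_⟩⟩
    · cases (η x).ownMode ν <;> simp
    · funext y
      by_cases h : y = x
      · subst h
        simp [instModes, restrictTo]
      · simp [instModes, restrictTo, h]

/-- If the instances of some literals have succeeded, one of the systems collected from these
literals is satisfied by the concrete norms and values. -/
theorem exists_mem_bodySystems {K : Config} {ν : LinNorm} {A : List Cell} {η : ℕ → Term}
    {ls : List Literal} (h : ∀ l ∈ ls, LitDescribed K ν A (l.subst η)) :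
    ∃ S ∈ K.bodySystems ν A (instModes ν η) ls, ∀ c ∈ S, c.holds (instVal ν η) := by
  induction ls with
  | nil => exact ⟨[], by simp [Config.bodySystems]⟩
  | cons l ls ih =>
    obtain ⟨hl, hls⟩ := List.forall_mem_cons.1 h
    obtain ⟨S, hS, hv⟩ := ih hls
    cases l with
    | atom a =>
      have hmodes : K.ownModes ν (a.subst η) = K.atomModes ν (instModes ν η) a :=
        K.ownModes_subst ν η a
      refine ⟨(K.cell K.ans ν (a.subst η)).constrs K.ans (a.argExp ν) ++ S, ?_, fun c hc => ?_⟩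
      · refine List.mem_flatMap.2 ⟨_, List.mem_filter.2 ⟨hl, ?_⟩, List.mem_map.2 ⟨S, hS, rfl⟩⟩
        simp [Config.cell, hmodes]
      · rcases List.mem_append.1 hc with hc | hc
        · exact K.holds_of_mem_constrs (fun u hu => Atom.eval_argExp hu) hc
        · exact hv c hc
    | cmp s ρ t =>
      obtain ⟨a, b, ha, hb, hρ⟩ := hl
      have h1 := Term.intIf_of_value_subst (ν := ν) ha
      have h2 := Term.intIf_of_value_subst (ν := ν) hb
      refine ⟨⟨s.valExp, ρ, t.valExp⟩ :: S, ?_, List.forall_mem_cons.2 ⟨?_, hv⟩⟩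
      · simp only [Config.bodySystems, instModes, h1, h2, Bool.and_self, if_true]
        exact List.mem_map.2 ⟨S, hS, rfl⟩
      · rw [Term.value_subst h1, Option.some.injEq] at ha
        rw [Term.value_subst h2, Option.some.injEq] at hb
        simpa only [Constr.holds, ha, hb] using hρ
    | assign t e =>
      obtain ⟨z, ht, he⟩ := hl
      have ht : (t.subst η).value = some z := by rw [ht]; rfl
      have h1 := Term.intIf_of_value_subst (ν := ν) ht
      have h2 := Term.intIf_of_value_subst (ν := ν) he
      refine ⟨⟨t.valExp, .le, e.valExp⟩ :: ⟨t.valExp, .ge, e.valExp⟩ :: S, ?_,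
        List.forall_mem_cons.2 ⟨?_, List.forall_mem_cons.2 ⟨?_, hv⟩⟩⟩
      · simp only [Config.bodySystems, instModes, h1, h2, Bool.and_self, if_true]
        exact List.mem_map.2 ⟨S, hS, rfl⟩
      all_goals
        rw [Term.value_subst h1, Option.some.injEq] at ht
        rw [Term.value_subst h2, Option.some.injEq] at he
        simp [Constr.holds, Rel.holds, ht, he]

theorem Clause.holds_of_mem_nonneg {c : Clause} {k : Constr Unknown} (hk : k ∈ c.nonneg)
    (ν : LinNorm) (η : ℕ → Term) : k.holds (instVal ν η) := by
  obtain ⟨x, -, rfl⟩ := List.mem_map.1 hk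
  simp [Constr.holds, Rel.holds, AExp.eval, instVal]

/-- Every closed set of abstract answers describes all provable literals. -/
theorem Provable.described {K : Config} {σ : Solver} {ν : LinNorm} {P : Program} {A : List Cell}
    (hA : K.answerStep σ ν P A ⊆ A) {l : Literal} (h : Provable P l) : LitDescribed K ν A l := by
  induction h with
  | atom c hc η h ih =>
    rw [← c.head_subst_restrictTo]
    have ih : ∀ l ∈ c.body, LitDescribed K ν A (l.subst (restrictTo c.vars η)) := fun l hl => by
      rw [Clause.literal_subst_restrictTo hl]
      exact ih l hl
    obtain ⟨S, hS, hv⟩ := exists_mem_bodySystems ih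
    have hcell := K.cell_mem_cellsWith K.ans ν (c.head.subst (restrictTo c.vars η))
    rw [K.ownModes_subst, Atom.pred_subst] at hcell
    refine hA <| List.mem_flatMap.2 ⟨c, hc, List.mem_flatMap.2
      ⟨_, instModes_mem_modeAssignments ν η c.vars, List.mem_flatMap.2 ⟨S, hS,
        List.mem_filter.2 ⟨hcell, ?_⟩⟩⟩⟩
    rw [Bool.not_eq_true', σ.not_refutes (v := instVal ν (restrictTo c.vars η)) fun k hk => ?_]
    rcases List.mem_append.1 hk with hk | hk
    · rcases List.mem_append.1 hk with hk | hk
      · exact hv k hk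
      · exact c.holds_of_mem_nonneg hk ν _
    · exact K.holds_of_mem_constrs (fun u hu => Atom.eval_argExp hu) hk
  | cmp l r ρ a b hl hr hρ => exact ⟨a, b, hl, hr, hρ⟩
  | assign e z he => exact ⟨z, rfl, he⟩

/-! ### Query-mapping pairs describe calls -/

/-- The value of a node of a mapping whose domain, middle atom and range abstract the given
atoms. -/
def nodeVal (ν : LinNorm) (D M B : Atom) : Node → ℤ
  | (.dom, u) => D.attr ν u
  | (.mid, u) => M.attr ν u
  | (.ran, u) => B.attr ν u

/-- The unknowns that stand for nodes of mappings, evaluated at concrete atoms. -/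
def mapVal (ν : LinNorm) (D M B : Atom) : Unknown → ℤ
  | .var _ _ => 0
  | .node u => nodeVal ν D M B u

theorem mem_nodes {s : Side} {d : Cell} {u : Node} :
    u ∈ d.nodes s ↔ u.1 = s ∧ definedIn d.modes u.2 = true := by
  obtain ⟨s', j, k⟩ := u
  simp only [Cell.nodes, List.mem_filter, List.mem_flatMap, List.mem_range, List.mem_cons,
    Prod.mk.injEq, List.not_mem_nil, or_false, and_congr_left_iff]
  intro h
  have hj : j < d.modes.length := by
    by_contra hj
    simp [definedIn, List.getElem?_eq_none (not_lt.1 hj)] at h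
  constructor
  · rintro ⟨_, _, h | h⟩ <;> exact h.1
  · rintro rfl
    exact ⟨j, hj, by cases k <;> simp⟩

/-- A node of a mapping that is defined. -/
def IsNode (δ ρ : Cell) (u : Node) : Prop :=
  u.1 = .dom ∧ definedIn δ.modes u.2 = true ∨ u.1 = .ran ∧ definedIn ρ.modes u.2 = true

theorem mem_nodePairs {δ ρ : Cell} {p : Node × Node} :
    p ∈ nodePairs δ ρ ↔ (IsNode δ ρ p.1 ∧ IsNode δ ρ p.2) ∧ p.1.2.2 = p.2.2.2 := by
  obtain ⟨u, v⟩ := p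
  simp [nodePairs, mem_nodes, IsNode, List.pair_mem_product]

/-- The query, domain and range of the pair are the abstractions of `A`, `D` and `B`, and its arcs
and edges, which join defined nodes, are true of the attributes of `D` and `B`.  Here `B` is an atom
reached by calls from `A`, and `D` is the instance of `A` in the first of these calls. -/
structure QMPair.Describes (K : Config) (ν : LinNorm) (μ : QMPair) (A D B : Atom) : Prop where
  query : μ.query = K.cell K.call ν A
  dom : μ.dom = K.cell K.call ν D
  ran : μ.ran = K.cell K.call ν B
  arcs : ∀ p ∈ μ.arcs, p ∈ nodePairs μ.dom μ.ran ∧ nodeVal ν D D B p.2 < nodeVal ν D D B p.1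
  edges : ∀ p ∈ μ.edges, p ∈ nodePairs μ.dom μ.ran ∧ nodeVal ν D D B p.1 = nodeVal ν D D B p.2

/-- If the concrete atoms satisfy the system `S`, then the pair made from `S` is not dropped, and
what the solver deduces from `S` is true of them. -/
theorem exists_mem_mkPair {K : Config} {σ : Solver} {ν : LinNorm} {A D B : Atom}
    {S : List (Constr Unknown)} {e : Node → AExp Unknown} {v : Unknown → ℤ}
    (hS : ∀ c ∈ S, c.holds v)
    (he : ∀ u, IsNode (K.cell K.call ν D) (K.cell K.call ν B) u →
      (e u).eval v = nodeVal ν D D B u) :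
    ∃ μ ∈ mkPair σ S e (K.cell K.call ν A) (K.cell K.call ν D) (K.cell K.call ν B),
      μ.Describes K ν A D B := by
  rw [mkPair, σ.not_refutes hS, if_neg Bool.false_ne_true]
  refine ⟨_, List.mem_singleton.2 rfl, rfl, rfl, rfl, fun p hp => ?_, fun p hp => ?_⟩
  · obtain ⟨hp, hr⟩ := List.mem_filter.1 hp
    obtain ⟨⟨h1, h2⟩, -⟩ := mem_nodePairs.1 hp
    have := σ.not_holds_of_refutes hS hr
    simp only [Constr.holds, Rel.holds, he _ h1, he _ h2, not_le] at this
    exact ⟨hp, this⟩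
  · obtain ⟨hp, hr⟩ := List.mem_filter.1 hp
    obtain ⟨⟨h1, h2⟩, -⟩ := mem_nodePairs.1 hp
    rw [Bool.and_eq_true] at hr
    have hlt := σ.not_holds_of_refutes hS hr.1
    have hgt := σ.not_holds_of_refutes hS hr.2
    simp only [Constr.holds, Rel.holds, he _ h1, he _ h2] at hlt hgt
    exact ⟨hp, by omega⟩

theorem subset_of_mem_bodyCalls {L : List Literal} {pa : List Literal × Atom}
    (h : pa ∈ bodyCalls L) : pa.1 ⊆ L ∧ .atom pa.2 ∈ L := by
  induction L generalizing pa with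
  | nil => simp [bodyCalls] at h
  | cons l L ih =>
    rcases List.mem_append.1 h with h | h
    · cases l <;> simp_all [Literal.atom?]
    · obtain ⟨pa', h', rfl⟩ := List.mem_map.1 h
      obtain ⟨h1, h2⟩ := ih h'
      exact ⟨List.cons_subset_cons l h1, List.mem_cons_of_mem _ h2⟩

/-- A call is described by a pair generated from the abstraction of the calling atom. -/
theorem Calls.exists_mem_stepPairs {K : Config} {σ : Solver} {ν : LinNorm} {P : Program}
    {A : List Cell} (hA : K.answerStep σ ν P A ⊆ A) {Q D B : Atom} (h : Calls P Q D B) :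
    ∃ μ ∈ K.stepPairs σ ν P A (K.cell K.call ν Q), μ.Describes K ν Q D B := by
  obtain ⟨c, hc, η, θ, hD, hcD, pa, hpa, hpre, hB⟩ := h
  obtain ⟨hpre', hatom⟩ := subset_of_mem_bodyCalls hpa
  rw [← c.head_subst_restrictTo] at hcD
  have hB' : Literal.atom B = .atom (pa.2.subst (restrictTo c.vars η)) := by
    have := Clause.literal_subst_restrictTo hatom η
    rw [hB]
    exact this.symm
  rw [Literal.atom.injEq] at hB'
  have hpre : ∀ l ∈ pa.1, LitDescribed K ν A (l.subst (restrictTo c.vars η)) := fun l hl => by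
    rw [Clause.literal_subst_restrictTo (hpre' hl)]
    exact (hpre l hl).described hA
  have hm := instModes_mem_modeAssignments ν η c.vars
  clear hB
  generalize restrictTo c.vars η = η at *
  obtain ⟨S, hS, hv⟩ := exists_mem_bodySystems hpre
  have hpred : D.pred = Q.pred := by rw [hD, Atom.pred_subst]
  have hδ : K.cell K.call ν D ∈
      cellsWith K.call c.head.pred (K.atomModes ν (instModes ν η) c.head) := by
    have := K.cell_mem_cellsWith K.call ν (c.head.subst η)
    rwa [K.ownModes_subst, Atom.pred_subst, hcD] at this
  have hρ : K.cell K.call ν B ∈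
      cellsWith K.call pa.2.pred (K.atomModes ν (instModes ν η) pa.2) := by
    have := K.cell_mem_cellsWith K.call ν (pa.2.subst η)
    rwa [K.ownModes_subst, Atom.pred_subst, ← hB'] at this
  have hext := K.cell_extendsTo K.call ν Q θ
  rw [← hD] at hext
  have argH : ∀ u, definedIn (K.ownModes ν D) u = true →
      (c.head.argExp ν u).eval (instVal ν η) = D.attr ν u := by
    rw [← hcD]
    exact fun u hu => Atom.eval_argExp hu
  have argB : ∀ u, definedIn (K.ownModes ν B) u = true →
      (pa.2.argExp ν u).eval (instVal ν η) = B.attr ν u := by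
    rw [hB']
    exact fun u hu => Atom.eval_argExp hu
  obtain ⟨μ, hμ, hd⟩ := exists_mem_mkPair (K := K) (σ := σ) (ν := ν) (A := Q) (D := D) (B := B)
    (S := S ++ c.nonneg ++ (K.cell K.call ν D).constrs K.call (c.head.argExp ν) ++
      (K.cell K.call ν B).constrs K.call (pa.2.argExp ν)) (e := stepExp ν c.head pa.2)
    (v := instVal ν η) (fun k hk => by
      simp only [List.mem_append] at hk
      rcases hk with ((hk | hk) | hk) | hk
      · exact hv k hk
      · exact c.holds_of_mem_nonneg hk ν _
      · exact K.holds_of_mem_constrs argH hk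
      · exact K.holds_of_mem_constrs argB hk)
    (fun u hu => by
      obtain ⟨s, u⟩ := u
      rcases hu with ⟨rfl, hu⟩ | ⟨rfl, hu⟩
      · exact argH u hu
      · exact argB u hu)
  refine ⟨μ, ?_, hd⟩
  have hhead : (c.head.pred == (K.cell K.call ν Q).pred) = true := by
    rw [beq_iff_eq, ← Atom.pred_subst η, hcD]
    exact hpred
  exact List.mem_flatMap.2 ⟨c, List.mem_filter.2 ⟨hc, hhead⟩, List.mem_flatMap.2 ⟨_, hm,
    List.mem_flatMap.2 ⟨pa, hpa, List.mem_flatMap.2 ⟨S, hS, List.mem_flatMap.2 ⟨_,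
      List.mem_filter.2 ⟨hδ, hext⟩, List.mem_flatMap.2 ⟨_, hρ, hμ⟩⟩⟩⟩⟩⟩

theorem Config.holds_of_mem_nodeConstrs {K : Config} {C : Family} {ν : LinNorm} {s : Side}
    {a : Atom} {v : Unknown → ℤ}
    (hv : ∀ u, definedIn (K.ownModes ν a) u = true → v (.node (s, u)) = a.attr ν u)
    {c : Constr Unknown} (hc : c ∈ (K.cell C ν a).nodeConstrs C s) : c.holds v := by
  rcases List.mem_append.1 hc with hc | hc
  · exact K.holds_of_mem_constrs (e := fun u => nodeExp (s, u)) hv hc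
  · obtain ⟨u, hu, rfl⟩ := List.mem_map.1 hc
    obtain ⟨hu, hk⟩ := List.mem_filter.1 hu
    obtain ⟨rfl, hd⟩ := mem_nodes.1 hu
    have h1 := hv u.2 hd
    have h2 := a.attr_size_nonneg ν (u := u.2) (by simpa using hk)
    simp only [Constr.holds, Rel.holds, AExp.eval, nodeExp]
    exact h2.trans_eq h1.symm

/-- The constraints expressed by the arcs and edges hold wherever the nodes are placed, provided
that the valuation agrees with the attributes that are defined. -/
theorem QMPair.Describes.holds_of_mem_arcConstrs {K : Config} {ν : LinNorm} {μ : QMPair}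
    {A D B : Atom} (h : μ.Describes K ν A D B) {s t : Side} {v : Unknown → ℤ}
    (hs : ∀ u, definedIn (K.ownModes ν D) u = true → v (.node (s, u)) = D.attr ν u)
    (ht : ∀ u, definedIn (K.ownModes ν B) u = true → v (.node (t, u)) = B.attr ν u)
    {c : Constr Unknown} (hc : c ∈ μ.arcConstrs s t) : c.holds v := by
  have key : ∀ u, IsNode μ.dom μ.ran u →
      (nodeExp (if u.1 = .dom then s else t, u.2)).eval v = nodeVal ν D D B u := by
    rw [h.dom, h.ran]
    rintro ⟨r, u⟩ (⟨rfl, hu⟩ | ⟨rfl, hu⟩)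
    · exact hs u hu
    · exact ht u hu
  rcases List.mem_append.1 hc with hc | hc
  · obtain ⟨p, hp, rfl⟩ := List.mem_map.1 hc
    obtain ⟨hn, hlt⟩ := h.arcs p hp
    obtain ⟨⟨h1, h2⟩, -⟩ := mem_nodePairs.1 hn
    simp only [Constr.holds, Rel.holds, key _ h1, key _ h2]
    exact hlt
  · obtain ⟨p, hp, hc⟩ := List.mem_flatMap.1 hc
    obtain ⟨hn, heq⟩ := h.edges p hp
    obtain ⟨⟨h1, h2⟩, -⟩ := mem_nodePairs.1 hn
    simp only [List.mem_cons, List.not_mem_nil, or_false] at hc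
    rcases hc with rfl | rfl
    · simp only [Constr.holds, Rel.holds, key _ h1, key _ h2]
      exact heq.le
    · simp only [Constr.holds, Rel.holds, key _ h1, key _ h2]
      exact heq.ge

/-- Composition of descriptions.  The domain of the first pair is kept: what its arcs and edges say
about the middle atom remains true when this atom is instantiated by the second chain of calls. -/
theorem QMPair.Describes.exists_mem_compose {K : Config} {ν : LinNorm} {μ μ' : QMPair}
    {A D B D' B' : Atom} (h : μ.Describes K ν A D B) (h' : μ'.Describes K ν B D' B')
    {θ : ℕ → Term} (hθ : D' = B.subst θ) (σ : Solver) :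
    ∃ κ ∈ K.compose σ μ μ', κ.Describes K ν A D B' := by
  have hran : μ.ran = μ'.query := by rw [h.ran, h'.query]
  have hself : μ.dom.extendsTo K.call μ.dom = true := by
    have := K.cell_extendsTo K.call ν D .var
    rwa [Atom.subst_var, ← h.dom] at this
  have hall : μ.dom ∈ K.allCells K.call μ.dom.pred := by
    rw [h.dom]
    exact K.cell_mem_allCells K.call ν D
  obtain ⟨κ, hκ, hd⟩ := exists_mem_mkPair (K := K) (σ := σ) (ν := ν) (A := A) (D := D) (B := B')
    (S := μ.arcConstrs .dom .mid ++ μ'.arcConstrs .mid .ran ++ μ.dom.nodeConstrs K.call .dom ++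
        μ'.dom.nodeConstrs K.call .mid ++ μ'.ran.nodeConstrs K.call .ran) (e := nodeExp)
    (v := mapVal ν D D' B') (fun c hc => by
      rw [h.dom, h'.dom, h'.ran] at hc
      simp only [List.mem_append] at hc
      rcases hc with (((hc | hc) | hc) | hc) | hc
      · refine h.holds_of_mem_arcConstrs (fun u _ => rfl) (fun u hu => ?_) hc
        rw [← Atom.attr_subst hu θ, ← hθ]
        rfl
      · exact h'.holds_of_mem_arcConstrs (fun u _ => rfl) (fun u _ => rfl) hc
      · exact K.holds_of_mem_nodeConstrs (fun u _ => rfl) hc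
      · exact K.holds_of_mem_nodeConstrs (fun u _ => rfl) hc
      · exact K.holds_of_mem_nodeConstrs (fun u _ => rfl) hc)
    (fun u hu => by
      obtain ⟨s, u⟩ := u
      rcases hu with ⟨rfl, -⟩ | ⟨rfl, -⟩ <;> rfl)
  refine ⟨κ, ?_, hd⟩
  -- Among the admissible domains of the composition, the domain of the first pair is chosen.
  rw [← h.query, ← h.dom, ← h'.ran] at hκ
  rw [Config.compose, if_pos hran]
  exact List.mem_flatMap.2 ⟨_, List.mem_filter.2 ⟨hall, hself⟩, hκ⟩

theorem Config.cell_mem_initialCells {K : Config} {ν : LinNorm} {q : Pattern} {Q : Atom}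
    (h : Q.Matches ν q) : K.cell K.call ν Q ∈ K.initialCells q := by
  have hpred : q.pred = Q.pred := by simp [Pattern.pred, Atom.pred, h.1, h.2.length_eq]
  refine List.mem_filter.2 ⟨hpred ▸ K.cell_mem_allCells K.call ν Q, ?_⟩
  rw [List.all_eq_true]
  intro x hx
  obtain ⟨j, hj, rfl⟩ := List.getElem_of_mem hx
  simp only [List.length_zip, List.length_zipIdx, lt_min_iff] at hj
  have hja : j < Q.args.length := by rw [h.2.length_eq]; exact hj.1
  have hm : Term.Matches ν Q.args[j] q.modes[j] := (List.forall₂_iff_get.1 h.2).2 j hja hj.1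
  simp only [List.getElem_zip, List.getElem_zipIdx, Config.cell, Config.ownModes,
    Config.atomModes, List.getElem_mapIdx, hpred, zero_add]
  refine K.absMode_le ?_
  change (q.modes[j].le (Q.args[j].ownMode ν)) = true
  generalize q.modes[j] = md at hm
  cases md with
  | f => rfl
  | b => simpa [Mode.le] using Term.ownMode_ne_f.2 hm
  | i =>
    obtain ⟨z, hz⟩ := hm
    simp [Mode.le, Term.ownMode_eq, hz]

/-! ### Recurrent pairs -/

theorem exists_reflTransGen_of_mem_reach {α : Type} [DecidableEq α] {next : α → List α} {z : α}
    (n : ℕ) {L : List α} (h : z ∈ reach next n L) :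
    ∃ x ∈ L, Relation.ReflTransGen (fun a b => b ∈ next a) x z := by
  induction n generalizing L with
  | zero => exact ⟨z, h, .refl⟩
  | succ n ih =>
    obtain ⟨x, hx, hz⟩ := ih h
    rcases List.mem_append.1 (List.mem_dedup.1 hx) with hx | hx
    · exact ⟨x, hx, hz⟩
    · obtain ⟨y, hy, hxy⟩ := List.mem_flatMap.1 hx
      exact ⟨y, hy, hz.head hxy⟩

/-- The pair describes infinitely many successive segments of a chain of calls: `X` holds for the
domain and the range of each segment, and the range of a segment is the query of another one. -/
structure QMPair.Recurs (K : Config) (ν : LinNorm) (μ : QMPair) (X : Atom → Atom → Prop) :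
    Prop where
  nonempty : ∃ D B, X D B
  describes : ∀ {D B}, X D B → ∃ A, μ.Describes K ν A D B
  next : ∀ {D B}, X D B → ∃ D' B', X D' B' ∧ ∃ θ : ℕ → Term, D' = B.subst θ

/-- A natural number cannot decrease along the segments for ever. -/
theorem QMPair.Recurs.not_descending {K : Config} {ν : LinNorm} {μ : QMPair}
    {X : Atom → Atom → Prop} (h : μ.Recurs K ν X) (f : Atom → Atom → ℕ)
    (hf : ∀ D B, X D B → ∃ D' B', X D' B' ∧ f D' B' < f D B) : False := by
  obtain ⟨D, B, hX⟩ := h.nonempty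
  induction hn : f D B using Nat.strong_induction_on generalizing D B with
  | _ n ih =>
    obtain ⟨D', B', hX', hlt⟩ := hf D B hX
    exact ih _ (hn ▸ hlt) D' B' hX' rfl

theorem QMPair.Recurs.false_of_decreases {K : Config} {σ : Solver} {ν : LinNorm} {μ : QMPair}
    {X : Atom → Atom → Prop} (h : μ.Recurs K ν X) (hc : μ.query = μ.ran) {φ : AExp Arg}
    (hφ : K.decreases σ μ φ = true) : False := by
  simp only [Config.decreases, Bool.and_eq_true, List.all_eq_true, beq_iff_eq] at hφ
  obtain ⟨⟨hdef, hnonneg⟩, hdecr⟩ := hφ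
  have key : ∀ D B, X D B →
      0 ≤ φ.eval (D.attr ν) ∧ φ.eval (B.attr ν) < φ.eval (D.attr ν) := fun D B hX => by
    obtain ⟨A, hd⟩ := h.describes hX
    have hS : ∀ c ∈ μ.arcConstrs .dom .ran ++ μ.dom.nodeConstrs K.call .dom ++
        μ.ran.nodeConstrs K.call .ran, c.holds (mapVal ν D D B) := by
      intro c hc
      rw [hd.dom, hd.ran] at hc
      simp only [List.mem_append] at hc
      rcases hc with (hc | hc) | hc
      · exact hd.holds_of_mem_arcConstrs (fun u _ => rfl) (fun u _ => rfl) hc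
      · exact K.holds_of_mem_nodeConstrs (fun u _ => rfl) hc
      · exact K.holds_of_mem_nodeConstrs (fun u _ => rfl) hc
    have h1 := σ.not_holds_of_refutes hS hnonneg
    have h2 := σ.not_holds_of_refutes hS hdecr
    simp only [Constr.holds, Rel.holds, AExp.eval_subst, nodeExp, AExp.eval, mapVal, nodeVal,
      not_lt, not_le] at h1 h2
    exact ⟨h1, h2⟩
  refine h.not_descending (fun D _ => (φ.eval (D.attr ν)).toNat) fun D B hX => ?_
  obtain ⟨A, hd⟩ := h.describes hX
  obtain ⟨D', B', hX', θ, hθ⟩ := h.next hX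
  refine ⟨D', B', hX', ?_⟩
  -- The function only involves values that are defined in the range, hence preserved in `D'`.
  have h3 : φ.eval (D'.attr ν) = φ.eval (B.attr ν) := AExp.eval_congr fun u hu => by
    have := (hdef u hu).2
    rw [hc, hd.ran] at this
    rw [hθ]
    exact Atom.attr_subst this θ
  have h1 := key D B hX
  have h2 := key D' B' hX'
  omega

theorem QMPair.mem_moves {μ : QMPair} {x y : Node} {f g : Bool}
    (h : (y, g) ∈ μ.moves (x, f)) :
    x.2.2 = .size ∧ ((g = true ∧ (x, y) ∈ μ.arcs) ∨
      (g = f ∧ ((x, y) ∈ μ.edges ∨ (y, x) ∈ μ.edges)) ∨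
      (g = f ∧ x.1 = .ran ∧ y = (.dom, x.2))) := by
  rw [QMPair.moves] at h
  split_ifs at h with hk hr
  · refine ⟨hk, ?_⟩
    simp only [List.mem_append, List.mem_filterMap, Option.ite_none_right_eq_some,
      Option.some.injEq, Prod.mk.injEq, List.mem_singleton] at h
    rcases h with ((⟨p, hp, rfl, rfl, rfl⟩ | ⟨p, hp, rfl, rfl, rfl⟩) |
      ⟨p, hp, rfl, rfl, rfl⟩) | ⟨rfl, rfl⟩
    · exact .inl ⟨rfl, hp⟩
    · exact .inr (.inl ⟨rfl, .inl hp⟩)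
    · exact .inr (.inl ⟨rfl, .inr hp⟩)
    · exact .inr (.inr ⟨rfl, hr, rfl⟩)
  · refine ⟨hk, ?_⟩
    simp only [List.mem_append, List.mem_filterMap, Option.ite_none_right_eq_some,
      Option.some.injEq, Prod.mk.injEq, List.not_mem_nil, or_false] at h
    rcases h with (⟨p, hp, rfl, rfl, rfl⟩ | ⟨p, hp, rfl, rfl, rfl⟩) | ⟨p, hp, rfl, rfl, rfl⟩
    · exact .inl ⟨rfl, hp⟩
    · exact .inr (.inl ⟨rfl, .inl hp⟩)
    · exact .inr (.inl ⟨rfl, .inr hp⟩)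
  · simp at h

/-- A walk in the circular variant never increases the value of the node, and decreases it when an
arc is traversed; a circular edge leads to the next segment. -/
theorem QMPair.Recurs.exists_le_of_walk {K : Config} {ν : LinNorm} {μ : QMPair}
    {X : Atom → Atom → Prop} (h : μ.Recurs K ν X) {u : Node} (hu : IsNode μ.dom μ.ran u)
    {w : Node × Bool} (hw : Relation.ReflTransGen (fun a b => b ∈ μ.moves a) (u, false) w)
    {D B : Atom} (hX : X D B) :
    ∃ D' B', X D' B' ∧ (w.1.1 = .ran → definedIn μ.ran.modes w.1.2 = true) ∧
      nodeVal ν D' D' B' w.1 ≤ nodeVal ν D D B u ∧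
      (w.2 = true → nodeVal ν D' D' B' w.1 < nodeVal ν D D B u) := by
  have hran : ∀ {x : Node}, IsNode μ.dom μ.ran x → x.1 = .ran →
      definedIn μ.ran.modes x.2 = true := by
    rintro x (⟨h1, -⟩ | ⟨-, h2⟩) hx
    · simp [h1] at hx
    · exact h2
  induction hw with
  | refl => exact ⟨D, B, hX, hran hu, le_rfl, by simp⟩
  | @tail x w _ hxw ih =>
    obtain ⟨x, f⟩ := x
    obtain ⟨y, g⟩ := w
    obtain ⟨D', B', hX', hdef, hle, hlt⟩ := ih
    obtain ⟨A, hd⟩ := h.describes hX'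
    simp only at hdef hle hlt ⊢
    obtain ⟨-, ⟨rfl, ha⟩ | ⟨rfl, he | he⟩ | ⟨rfl, hr, rfl⟩⟩ := QMPair.mem_moves hxw
    · obtain ⟨hn, hv⟩ := hd.arcs _ ha
      simp only at hv
      exact ⟨D', B', hX', hran (mem_nodePairs.1 hn).1.2, by omega, fun _ => by omega⟩
    · obtain ⟨hn, hv⟩ := hd.edges _ he
      simp only at hv
      rw [hv] at hle hlt
      exact ⟨D', B', hX', hran (mem_nodePairs.1 hn).1.2, hle, hlt⟩
    · obtain ⟨hn, hv⟩ := hd.edges _ he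
      simp only at hv
      rw [← hv] at hle hlt
      exact ⟨D', B', hX', hran (mem_nodePairs.1 hn).1.1, hle, hlt⟩
    · obtain ⟨D'', B'', hX'', θ, hθ⟩ := h.next hX'
      obtain ⟨s, a⟩ := x
      obtain rfl : s = .ran := hr
      have hda : definedIn (K.ownModes ν B') a = true := by
        have := hdef rfl
        rwa [hd.ran] at this
      have hv : nodeVal ν D'' D'' B'' (.dom, a) = nodeVal ν D' D' B' (.ran, a) := by
        simp only [nodeVal, hθ, Atom.attr_subst hda θ]
      rw [← hv] at hle hlt
      exact ⟨D'', B'', hX'', by simp, hle, hlt⟩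

theorem QMPair.Recurs.false_of_forwardPositiveCycle {K : Config} {ν : LinNorm} {μ : QMPair}
    {X : Atom → Atom → Prop} (h : μ.Recurs K ν X) (hc : μ.forwardPositiveCycle = true) : False := by
  obtain ⟨u, hu, hr⟩ := List.any_eq_true.1 hc
  have hu : IsNode μ.dom μ.ran u := by
    simpa only [List.mem_append, mem_nodes, IsNode] using hu
  obtain ⟨x, hx, hw⟩ := exists_reflTransGen_of_mem_reach _ (of_decide_eq_true hr)
  rw [List.mem_singleton] at hx
  subst hx
  -- The cycle contains a move, and only norm nodes have moves.
  have hk : u.2.2 = .size := by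
    rcases hw.cases_head with h | ⟨y, hy, -⟩
    · simp at h
    · exact (QMPair.mem_moves hy).1
  have hnonneg : ∀ D B, 0 ≤ nodeVal ν D D B u := by
    obtain ⟨s, a⟩ := u
    intro D B
    cases s <;> exact Atom.attr_size_nonneg ν _ hk
  refine h.not_descending (fun D B => (nodeVal ν D D B u).toNat) fun D B hX => ?_
  obtain ⟨D', B', hX', -, -, hlt⟩ := h.exists_le_of_walk hu hw hX
  have h1 := hlt rfl
  have h2 := hnonneg D' B'
  refine ⟨D', B', hX', ?_⟩
  simp only at h1 ⊢
  omega

/-! ### Soundness of the termination test -/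

/-- The pairs of a chain of calls, between any two of its atoms, come from a finite set.  Hence
there are a pair and a set of indices, given by an ultrafilter, such that each index of the set has
a successor in the set with which it is related by this pair.  This takes the place of Ramsey's
theorem. -/
theorem exists_recurrent {α : Type} {R : α → ℕ → ℕ → Prop} (M : List α)
    (h : ∀ i j, i < j → ∃ μ ∈ M, R μ i j) :
    ∃ μ ∈ M, ∃ S : Set ℕ, S.Nonempty ∧ ∀ i ∈ S, ∃ j ∈ S, R μ i j := by
  let U : Ultrafilter ℕ := Filter.hyperfilter ℕ
  have hfin : ∀ p : α → ℕ → Prop, (∀ᶠ i in (U : Filter ℕ), ∃ μ ∈ M, p μ i) →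
      ∃ μ ∈ M, ∀ᶠ i in (U : Filter ℕ), p μ i := by
    intro p hp
    have := (U.finite_biUnion_mem_iff (is := {μ | μ ∈ M}) (s := fun μ => {i | p μ i})
      (List.finite_toSet M)).1 (by
        filter_upwards [hp] with i ⟨μ, hμ, hi⟩
        exact Set.mem_biUnion (x := μ) hμ hi)
    exact this
  have hgt : ∀ i, ∀ᶠ j in (U : Filter ℕ), i < j := fun i => by
    have := (Filter.eventually_gt_atTop i)
    rw [← Nat.cofinite_eq_atTop] at this
    exact Filter.hyperfilter_le_cofinite this
  obtain ⟨μ, hμ, hS⟩ := hfin (fun μ i => ∀ᶠ j in (U : Filter ℕ), R μ i j)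
    (.of_forall fun i => hfin _ ((hgt i).mono fun j hj => h i j hj))
  refine ⟨μ, hμ, {i | ∀ᶠ j in (U : Filter ℕ), R μ i j}, U.nonempty_of_mem hS, fun i hi => ?_⟩
  obtain ⟨j, hj, hij⟩ := (hS.and hi).exists
  exact ⟨j, hj, hij⟩

/-- Each circular pair passes one of the two tests: its circular variant has a forward positive
cycle, or some polynomial function decreases. -/
def PassesTests (K : Config) (σ : Solver) (M : List QMPair) : Prop :=
  ∀ μ ∈ M, μ.circular = true → μ.forwardPositiveCycle = true ∨ ∃ φ, K.decreases σ μ φ = true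

/-- Closed lists of abstract answers and pairs whose circular members pass the tests certify that
every query matching the pattern terminates. -/
theorem terminates_of_passesTests {K : Config} {σ : Solver} {ν : LinNorm} {P : Program}
    {q : Pattern} {A : List Cell} {M : List QMPair} (hA : K.answerStep σ ν P A ⊆ A)
    (hM : K.pairStep σ ν P q A M ⊆ M) (htests : PassesTests K σ M) {Q : Atom}
    (hQ : Q.Matches ν q) : Terminates P [.atom Q] := by
  by_contra hnt
  have hstep : ∀ B : {B : Atom // ¬ Terminates P [.atom B]},
      ∃ (D : Atom) (B' : {B : Atom // ¬ Terminates P [.atom B]}), Calls P B D B' := by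
    rintro ⟨B, hB⟩
    by_contra! hcon
    refine hB (terminates_of_calls fun D B' hcall => ?_)
    by_contra hB'
    exact hcon D ⟨B', hB'⟩ hcall
  choose dom next hcalls using hstep
  let chain : ℕ → {B : Atom // ¬ Terminates P [.atom B]} := fun n => next^[n] ⟨Q, hnt⟩
  have hchain : ∀ n, Calls P (chain n) (dom (chain n)) (chain (n + 1)) := fun n => by
    simp only [chain, Function.iterate_succ_apply']
    exact hcalls _
  have hone : ∀ n, K.cell K.call ν (chain n) ∈ K.initialCells q ++ M.map QMPair.ran →
      ∃ μ ∈ M, μ.Describes K ν (chain n) (dom (chain n)) (chain (n + 1)) := fun n hn => by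
    obtain ⟨μ, hμ, hd⟩ := (hchain n).exists_mem_stepPairs (σ := σ) hA
    exact ⟨μ, hM (List.mem_append_left _ (List.mem_flatMap.2 ⟨_, hn, hμ⟩)), hd⟩
  have hcell : ∀ n, K.cell K.call ν (chain n) ∈ K.initialCells q ++ M.map QMPair.ran := by
    intro n
    induction n with
    | zero => exact List.mem_append_left _ (K.cell_mem_initialCells hQ)
    | succ n ih =>
      obtain ⟨μ, hμ, hd⟩ := hone n ih
      exact List.mem_append_right _ (List.mem_map.2 ⟨μ, hμ, hd.ran⟩)
  have hinst : ∀ n, ∃ θ : ℕ → Term, dom (chain n) = (chain n).1.subst θ := fun n => by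
    obtain ⟨_, _, _, θ, hθ, _⟩ := hchain n
    exact ⟨θ, hθ⟩
  have hpairs : ∀ i j, i < j →
      ∃ μ ∈ M, μ.Describes K ν (chain i) (dom (chain i)) (chain j) := by
    intro i j hij
    induction j, hij using Nat.le_induction with
    | base => exact hone i (hcell i)
    | succ j _ ih =>
      obtain ⟨μ, hμ, hd⟩ := ih
      obtain ⟨μ', hμ', hd'⟩ := hone j (hcell j)
      obtain ⟨θ, hθ⟩ := hinst j
      obtain ⟨κ, hκ, hd''⟩ := hd.exists_mem_compose hd' hθ σ
      exact ⟨κ, hM (List.mem_append_right _ (List.mem_flatMap.2 ⟨μ, hμ,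
        List.mem_flatMap.2 ⟨μ', hμ', hκ⟩⟩)), hd''⟩
  obtain ⟨μ, hμ, S, ⟨i, hi⟩, hS⟩ := exists_recurrent M hpairs
  have hrec : μ.Recurs K ν fun D B => ∃ i ∈ S, ∃ j ∈ S,
      μ.Describes K ν (chain i) (dom (chain i)) (chain j) ∧ D = dom (chain i) ∧ B = chain j := by
    refine ⟨?_, ?_, ?_⟩
    · obtain ⟨j, hj, hd⟩ := hS i hi
      exact ⟨_, _, i, hi, j, hj, hd, rfl, rfl⟩
    · rintro _ _ ⟨i, -, j, -, hd, rfl, rfl⟩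
      exact ⟨_, hd⟩
    · rintro _ _ ⟨i, -, j, hj, -, rfl, rfl⟩
      obtain ⟨k, hk, hd⟩ := hS j hj
      exact ⟨_, _, ⟨j, hj, k, hk, hd, rfl, rfl⟩, hinst j⟩
  have hcirc : μ.query = μ.ran := by
    obtain ⟨j, hj, hd⟩ := hS i hi
    obtain ⟨k, -, hd'⟩ := hS j hj
    rw [hd'.query, hd.ran]
  rcases htests μ hμ (beq_iff_eq.2 hcirc) with h | ⟨φ, hφ⟩
  · exact hrec.false_of_forwardPositiveCycle h
  · exact hrec.false_of_decreases hcirc hφ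

/-! ### Termination of the algorithm -/

theorem newElems_eq_nil {α : Type} [DecidableEq α] {L T : List α} :
    newElems L T = [] ↔ T ⊆ L := by
  rw [List.eq_nil_iff_forall_not_mem]
  simp only [newElems, List.mem_dedup, List.mem_filter, decide_eq_true_eq, not_and, not_not]
  rfl

/-- `t` is reached from `s` by iteration of `f`. -/
def IterTo {σ : Type} (f : σ → σ) (s t : σ) : Prop := ∃ n, f^[n] s = t

theorem IterTo.trans {σ : Type} {f : σ → σ} {s t u : σ} (h : IterTo f s t) (h' : IterTo f t u) :
    IterTo f s u := by
  obtain ⟨m, rfl⟩ := h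
  obtain ⟨n, rfl⟩ := h'
  exact ⟨n + m, Function.iterate_add_apply f n m s⟩

theorem IterTo.single {σ : Type} {f : σ → σ} {s t : σ} (h : f s = t) : IterTo f s t := ⟨1, h⟩

/-- A fixpoint computation whose results come from a finite set reaches the next phase, with a
closed list. -/
theorem exists_iterTo_of_fixpoint {α σ : Type} [DecidableEq α] {f : σ → σ} {F : List α → List α}
    (U : List α) (hU : ∀ L ⊆ U, F L ⊆ U) {phase next : List α → σ}
    (hf : ∀ L, f (phase L) =
      match newElems L (F L) with
      | [] => next L
      | n :: ns => phase (L ++ n :: ns)) :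
    ∃ L, F L ⊆ L ∧ IterTo f (phase []) (next L) := by
  -- The number of elements of `U` that are still missing decreases.
  have key : ∀ k, ∀ L ⊆ U, (U.toFinset \ L.toFinset).card = k →
      ∃ L', F L' ⊆ L' ∧ IterTo f (phase L) (next L') := by
    intro k
    induction k using Nat.strong_induction_on with
    | _ k ih =>
      intro L hL hk
      have hfL := hf L
      cases hnew : newElems L (F L) with
      | nil =>
        rw [hnew] at hfL
        exact ⟨L, newElems_eq_nil.1 hnew, .single hfL⟩
      | cons n ns =>
        rw [hnew] at hfL
        have hmem : ∀ x ∈ n :: ns, x ∈ U ∧ x ∉ L := by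
          intro x hx
          rw [← hnew, newElems, List.mem_dedup, List.mem_filter, decide_eq_true_eq] at hx
          exact ⟨hU L hL hx.1, hx.2⟩
        have hn := hmem n List.mem_cons_self
        obtain ⟨L', hL', hit⟩ := ih _ (by
          rw [← hk]
          refine Finset.card_lt_card (Finset.ssubset_iff_of_subset ?_ |>.2 ⟨n, ?_, ?_⟩)
          · refine Finset.sdiff_subset_sdiff subset_rfl fun x hx => ?_
            simp only [List.mem_toFinset, List.mem_append] at hx ⊢
            exact .inl hx
          · simpa using hn
          · simp) (L ++ n :: ns)
          (List.append_subset.2 ⟨hL, fun x hx => (hmem x hx).1⟩) rfl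
        exact ⟨L', hL', (IterTo.single hfL).trans hit⟩
  exact key _ [] (List.nil_subset U) rfl

/-- All cells that the abstract immediate consequence operator can produce. -/
def Config.answerUniverse (K : Config) (P : Program) : List Cell :=
  P.flatMap fun c => K.allCells K.ans c.head.pred

theorem Config.answerStep_subset (K : Config) (σ : Solver) (ν : LinNorm) (P : Program)
    (A : List Cell) : K.answerStep σ ν P A ⊆ K.answerUniverse P := by
  intro d hd
  obtain ⟨c, hc, hd⟩ := List.mem_flatMap.1 hd
  obtain ⟨m, -, hd⟩ := List.mem_flatMap.1 hd
  obtain ⟨S, -, hd⟩ := List.mem_flatMap.1 hd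
  exact List.mem_flatMap.2
    ⟨c, hc, K.cellsWith_subset_allCells _ ν m _ (List.mem_of_mem_filter hd)⟩

/-- The cells that can be ranges of generated pairs. -/
def Config.ranUniverse (K : Config) (P : Program) : List Cell :=
  P.flatMap fun c => (bodyCalls c.body).flatMap fun pa => K.allCells K.call pa.2.pred

/-- The cells that can be domains of generated pairs. -/
def Config.domUniverse (K : Config) (P : Program) : List Cell :=
  P.flatMap fun c => K.allCells K.call c.head.pred

/-- All pairs that can be generated. -/
def Config.pairUniverse (K : Config) (P : Program) (q : Pattern) : List QMPair :=
  (K.initialCells q ++ K.ranUniverse P).flatMap fun π =>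
    (K.domUniverse P).flatMap fun δ => (K.ranUniverse P).flatMap fun ρ =>
      (nodePairs δ ρ).sublists.flatMap fun arcs =>
        (nodePairs δ ρ).sublists.map fun edges => ⟨π, δ, ρ, arcs, edges⟩

theorem Config.mem_pairUniverse {K : Config} {P : Program} {q : Pattern} {μ : QMPair} :
    μ ∈ K.pairUniverse P q ↔ μ.query ∈ K.initialCells q ++ K.ranUniverse P ∧
      μ.dom ∈ K.domUniverse P ∧ μ.ran ∈ K.ranUniverse P ∧
      μ.arcs.Sublist (nodePairs μ.dom μ.ran) ∧ μ.edges.Sublist (nodePairs μ.dom μ.ran) := by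
  simp only [Config.pairUniverse, List.mem_flatMap, List.mem_map, List.mem_sublists]
  constructor
  · rintro ⟨π, hπ, δ, hδ, ρ, hρ, as, has, es, hes, rfl⟩
    exact ⟨hπ, hδ, hρ, has, hes⟩
  · rintro ⟨hπ, hδ, hρ, has, hes⟩
    exact ⟨_, hπ, _, hδ, _, hρ, _, has, _, hes, rfl⟩

theorem Config.mem_pairUniverse_of_mem_mkPair {K : Config} {P : Program} {q : Pattern}
    {σ : Solver} {S : List (Constr Unknown)} {e : Node → AExp Unknown} {π δ ρ : Cell}
    (hπ : π ∈ K.initialCells q ++ K.ranUniverse P) (hδ : δ ∈ K.domUniverse P)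
    (hρ : ρ ∈ K.ranUniverse P) {μ : QMPair} (hμ : μ ∈ mkPair σ S e π δ ρ) :
    μ ∈ K.pairUniverse P q := by
  rw [mkPair] at hμ
  split_ifs at hμ
  · simp at hμ
  · obtain rfl := List.mem_singleton.1 hμ
    exact Config.mem_pairUniverse.2 ⟨hπ, hδ, hρ, List.filter_sublist, List.filter_sublist⟩

theorem Config.pairStep_subset (K : Config) (σ : Solver) (ν : LinNorm) (P : Program) (q : Pattern)
    (A : List Cell) {M : List QMPair} (hM : M ⊆ K.pairUniverse P q) :
    K.pairStep σ ν P q A M ⊆ K.pairUniverse P q := by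
  intro κ hκ
  rcases List.mem_append.1 hκ with hκ | hκ
  · obtain ⟨π, hπ, hκ⟩ := List.mem_flatMap.1 hκ
    obtain ⟨c, hc, hκ⟩ := List.mem_flatMap.1 hκ
    obtain ⟨m, -, hκ⟩ := List.mem_flatMap.1 hκ
    obtain ⟨pa, hpa, hκ⟩ := List.mem_flatMap.1 hκ
    obtain ⟨S, -, hκ⟩ := List.mem_flatMap.1 hκ
    obtain ⟨δ, hδ, hκ⟩ := List.mem_flatMap.1 hκ
    obtain ⟨ρ, hρ, hκ⟩ := List.mem_flatMap.1 hκ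
    have hc := List.mem_of_mem_filter hc
    refine Config.mem_pairUniverse_of_mem_mkPair ?_ ?_ ?_ hκ
    · rcases List.mem_append.1 hπ with h | h
      · exact List.mem_append_left _ h
      · obtain ⟨μ, hμ, rfl⟩ := List.mem_map.1 h
        exact List.mem_append_right _ (Config.mem_pairUniverse.1 (hM hμ)).2.2.1
    · exact List.mem_flatMap.2
        ⟨c, hc, K.cellsWith_subset_allCells _ ν m _ (List.mem_of_mem_filter hδ)⟩
    · exact List.mem_flatMap.2
        ⟨c, hc, List.mem_flatMap.2 ⟨pa, hpa, K.cellsWith_subset_allCells _ ν m _ hρ⟩⟩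
  · obtain ⟨μ, hμ, hκ⟩ := List.mem_flatMap.1 hκ
    obtain ⟨μ', hμ', hκ⟩ := List.mem_flatMap.1 hκ
    rw [Config.compose] at hκ
    split_ifs at hκ with h
    · obtain ⟨δ, hδ, hκ⟩ := List.mem_flatMap.1 hκ
      obtain ⟨h1, h2, -⟩ := Config.mem_pairUniverse.1 (hM hμ)
      obtain ⟨-, -, h3, -⟩ := Config.mem_pairUniverse.1 (hM hμ')
      refine Config.mem_pairUniverse_of_mem_mkPair h1 ?_ h3 hκ
      obtain ⟨c, hc, hd⟩ := List.mem_flatMap.1 h2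
      have hp : μ.dom.pred = c.head.pred := by
        obtain ⟨modes, -, hd⟩ := List.mem_flatMap.1 hd
        obtain ⟨bits, -, hd⟩ := List.mem_map.1 hd
        rw [← hd]
      exact List.mem_flatMap.2 ⟨c, hc, hp ▸ List.mem_of_mem_filter hδ⟩
    · simp at hκ

/-- The abstract answers and the pairs that are computed are closed, and the circular pairs pass the
tests. -/
def Certified (P : Program) (q : Pattern) (ν : LinNorm) (σ : Solver) : Prop :=
  ∃ (K : Config) (A : List Cell) (M : List QMPair), K.answerStep σ ν P A ⊆ A ∧
    K.pairStep σ ν P q A M ⊆ M ∧ PassesTests K σ M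

theorem passesTests_cons {K : Config} {σ : Solver} {μ : QMPair} {M : List QMPair} :
    PassesTests K σ (μ :: M) ↔ (μ.circular = true → μ.forwardPositiveCycle = true ∨
      ∃ φ, K.decreases σ μ φ = true) ∧ PassesTests K σ M :=
  List.forall_mem_cons

theorem iterTo_termiLogTest (P : Program) (q : Pattern) (ν : LinNorm) (g : Choices)
    (M : List QMPair) :
    (PassesTests termiLogConfig g.solver M ∧
      IterTo (step P q ν g) (.termiLogTest M) (.halt .yes)) ∨
    IterTo (step P q ν g) (.termiLogTest M) .loopTest := by
  induction M with
  | nil => exact .inl ⟨by simp [PassesTests], .single rfl⟩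
  | cons μ M ih =>
    by_cases h : (!μ.circular || μ.forwardPositiveCycle) = true
    · have hs : IterTo (step P q ν g) (.termiLogTest (μ :: M)) (.termiLogTest M) :=
        .single (by simp only [step, h, if_true])
      refine ih.imp (fun ⟨h1, h2⟩ => ⟨passesTests_cons.2 ⟨fun hc => .inl ?_, h1⟩, hs.trans h2⟩)
        hs.trans
      simpa [hc] using h
    · exact .inr (.single (by simp only [step, h, if_false, Bool.false_eq_true]))

theorem iterTo_test (P : Program) (q : Pattern) (ν : LinNorm) (g : Choices) (K : Config)
    (M : List QMPair) :
    (PassesTests K g.solver M ∧ IterTo (step P q ν g) (.test K M) (.halt .yes)) ∨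
    IterTo (step P q ν g) (.test K M) (.halt .no) := by
  induction M with
  | nil => exact .inl ⟨by simp [PassesTests], .single rfl⟩
  | cons μ M ih =>
    by_cases h : (!μ.circular || μ.forwardPositiveCycle ||
        K.decreases g.solver μ (g.termFun μ)) = true
    · have hs : IterTo (step P q ν g) (.test K (μ :: M)) (.test K M) :=
        .single (by simp only [step, h, if_true])
      refine ih.imp (fun ⟨h1, h2⟩ => ⟨passesTests_cons.2 ⟨fun hc => ?_, h1⟩, hs.trans h2⟩)
        hs.trans
      simp only [hc, Bool.not_true, Bool.false_or, Bool.or_eq_true] at h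
      exact h.imp id fun h => ⟨_, h⟩
    · exact .inr (.single (by simp only [step, h, if_false, Bool.false_eq_true]))

/-- The algorithm halts, and it only answers `yes` with a certificate: the lists of its structural
phase, or those of its numerical phase. -/
theorem exists_iterTo_halt (P : Program) (q : Pattern) (ν : LinNorm) (g : Choices) :
    ∃ r, IterTo (step P q ν g) (.termiLogAnswers []) (.halt r) ∧
      (r = .yes → Certified P q ν g.solver) := by
  obtain ⟨A₁, hA₁, h₁⟩ := exists_iterTo_of_fixpoint (f := step P q ν g)
    (termiLogConfig.answerUniverse P)
    (fun L _ => termiLogConfig.answerStep_subset g.solver ν P L)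
    (phase := .termiLogAnswers) (next := fun A => .termiLogPairs A []) fun L => by
      rw [step]
      split <;> simp_all only
  obtain ⟨M₁, hM₁, h₂⟩ := exists_iterTo_of_fixpoint (f := step P q ν g)
    (termiLogConfig.pairUniverse P q)
    (fun L hL => termiLogConfig.pairStep_subset g.solver ν P q A₁ hL)
    (phase := .termiLogPairs A₁) (next := .termiLogTest) fun L => by
      rw [step]
      split <;> simp_all only
  have h₁₂ := h₁.trans h₂
  rcases iterTo_termiLogTest P q ν g M₁ with ⟨htests, h⟩ | h
  · exact ⟨.yes, h₁₂.trans h, fun _ => ⟨_, A₁, M₁, hA₁, hM₁, htests⟩⟩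
  have h₁₃ := h₁₂.trans h
  by_cases hloop : P.hasNumericalLoop = true
  swap
  · exact ⟨.no, h₁₃.trans (.single (by simp only [step, hloop, if_false, Bool.false_eq_true])),
      by simp⟩
  have h₁₄ := h₁₃.trans (t := State.loopTest) (u := State.numAnswers [])
    (.single (by simp only [step, hloop, if_true]))
  obtain ⟨A₂, -, h₃⟩ := exists_iterTo_of_fixpoint (f := step P q ν g)
    ((numConfig g).answerUniverse P)
    (fun L _ => (numConfig g).answerStep_subset g.solver ν P L)
    (phase := .numAnswers) (next := fun A => .numPairs A []) fun L => by
      rw [step]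
      split <;> simp_all only
  obtain ⟨M₂, -, h₄⟩ := exists_iterTo_of_fixpoint (f := step P q ν g)
    ((numConfig g).pairUniverse P q)
    (fun L hL => (numConfig g).pairStep_subset g.solver ν P q A₂ hL)
    (phase := .numPairs A₂)
    (next := fun M => .answers (mainConfig g P (verified g q A₂ M)) []) fun L => by
      rw [step]
      split <;> simp_all only
  have h₁₅ := (h₁₄.trans h₃).trans h₄
  generalize mainConfig g P (verified g q A₂ M₂) = K at h₁₅
  obtain ⟨A, hA, h₅⟩ := exists_iterTo_of_fixpoint (f := step P q ν g)
    (K.answerUniverse P) (fun L _ => K.answerStep_subset g.solver ν P L)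
    (phase := .answers K) (next := fun A => .pairs K A []) fun L => by
      rw [step]
      split <;> simp_all only
  obtain ⟨M, hM, h₆⟩ := exists_iterTo_of_fixpoint (f := step P q ν g)
    (K.pairUniverse P q) (fun L hL => K.pairStep_subset g.solver ν P q A hL)
    (phase := .pairs K A) (next := .test K) fun L => by
      rw [step]
      split <;> simp_all only
  have h₁₆ := (h₁₅.trans h₅).trans h₆
  rcases iterTo_test P q ν g K M with ⟨htests, h⟩ | h
  · exact ⟨.yes, h₁₆.trans h, fun _ => ⟨K, A, M, hA, hM, htests⟩⟩
  · exact ⟨.no, h₁₆.trans h, by simp⟩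

theorem analyse_halt_unique {P : Program} {q : Pattern} {ν : LinNorm} {g : Choices} {m n : ℕ}
    {r r' : Answer} (h : analyse P q ν g m = .halt r) (h' : analyse P q ν g n = .halt r') :
    r = r' := by
  have stay : ∀ (k : ℕ) (r : Answer), (step P q ν g)^[k] (.halt r) = .halt r := fun k r =>
    Function.iterate_fixed rfl k
  wlog hmn : m ≤ n generalizing m n r r'
  · exact (this h' h (le_of_not_ge hmn)).symm
  obtain ⟨k, rfl⟩ := Nat.exists_eq_add_of_le' hmn
  rw [analyse, Function.iterate_add_apply, ← analyse, h, stay] at h'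
  exact State.halt.inj h'

end LPTerm

theorem mainTheorem1 (P : LPTerm.Program) (q : LPTerm.Pattern) (ν : LPTerm.LinNorm)
    (g : LPTerm.Choices) :
    (∃ (n : ℕ) (r : LPTerm.Answer), LPTerm.analyse P q ν g n = LPTerm.State.halt r) ∧
    ((∃ n : ℕ, LPTerm.analyse P q ν g n = LPTerm.State.halt LPTerm.Answer.yes) →
      ∀ Q : LPTerm.Atom, Q.Matches ν q →
        ∀ T : LPTerm.LDTree P [LPTerm.Literal.atom Q], T.nodes.Finite) := by
  obtain ⟨r, ⟨n, hn⟩, hr⟩ := LPTerm.exists_iterTo_halt P q ν g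
  refine ⟨⟨n, r, hn⟩, fun ⟨m, hm⟩ Q hQ T => ?_⟩
  obtain ⟨K, A, M, hA, hM, htests⟩ := hr (LPTerm.analyse_halt_unique hn hm)
  exact T.finite_nodes (LPTerm.terminates_of_passesTests hA hM htests hQ)
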